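/- Let $k$ be a commutative ring (for instance a field of characteristic $0$), $R$ a commutative unital $k$-algebra, and $(R,L)$ a Lie--Rinehart pair over $k$: $L$ is a $k$-Lie algebra and an $R$-module, acting on $R$ by $k$-linear derivations $r\mapsto x(r)$ through an $R$-linear morphism of Lie algebras $L\to \mathrm{Der}_k(R)$, with $[x,ry]=r[x,y]+x(r)y$. Let $U=U(R,L)$ be its universal enveloping algebra, i.e. the quotient of the enveloping algebra of the $k$-Lie algebra $R\oplus L$, with $[(r_1,x_1),(r_2,x_2)]=(x_1(r_2)-x_2(r_1),[x_1,x_2])$, by the relations $r'\cdot(r+x)=r'r+r'x$ and $1_R=1$. It acts on $R$ ($R$ by multiplication, $L$ by derivations); it has the counit $\varepsilon_U(u)=u\cdot 1$ and the coproduct $\Delta_U(u)=\sum u_{1}\otimes u_{2}\in U\otimes_R U$ (tensor product of left $R$-modules), $\Delta_U(u)=u\cdot(1\otimes 1)$, where $r\in R$ acts on $U\otimes_RU$ through the left module structure and $x\in L$ by $x\cdot(u\otimes v)=xu\otimes v+u\otimes xv$; thus $\Delta_U(r)=r\otimes 1$ and $\Delta_U(x)=x\otimes 1+1\otimes x$.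 Let $H=\mathrm{Hom}_R(U,R)$ be the set of homomorphisms of left $R$-modules. The completed tensor powers of $H$ over $R$ (right unit on the left factor, left unit on the right factor) are $H\hat\otimes_R H=\mathrm{Hom}_R(U\otimes_R U,R)$ and $H\hat\otimes_R H\hat\otimes_R H=\mathrm{Hom}_R(U\otimes_R U\otimes_R U,R)$, where now the tensor products are those of $R$-bimodules ($ur\otimes v=u\otimes rv$); here $\varphi\otimes\psi$ is the functional $(u,v)\mapsto\varphi(u\,\psi(v))$, and $(FG)(u,v)=\sum F(u_1,v_1)G(u_2,v_2)$. Let $R$ carry a ring topology for which all the derivations $r\mapsto x(r)$, $x\in L$, are continuous (for instance the discrete one), and give these spaces the topology of pointwise convergence. Then the structure maps $$(\varphi\psi)(u)=\sum\varphi(u_1)\psi(u_2),\quad 1_H=\varepsilon_U,\quad \eta_L(r)(u)=r\,\varepsilon_U(u),\quad \eta_R(r)(u)=u\cdot r=\varepsilon_U(ur),\quad \Delta(\varphi)(u,v)=\varphi(uv),\quad \varepsilon(\varphi)=\varphi(1)$$ are well defined and make $(R,H)$ a topological, unital and counital commutative bialgebroid over $k$. That is: $H$ and $H\hat\otimes_RH$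 (with unit $1\otimes1$) are topological commutative associative unital $k$-algebras; $(\varphi,\psi)\mapsto\varphi\otimes\psi$ is continuous, multiplicative and satisfies $\varphi\,\eta_R(r)\otimes\psi=\varphi\otimes\eta_L(r)\,\psi$; $\eta_L$, $\eta_R$, $\varepsilon$ and $\Delta$ are continuous morphisms of unital $k$-algebras; and $$(\mathrm{id}\otimes\varepsilon)\Delta=(\varepsilon\otimes\mathrm{id})\Delta=\mathrm{id}_H,\quad \varepsilon\eta_L=\varepsilon\eta_R=\mathrm{id}_R,\quad \Delta\eta_L=\eta_L\otimes1,\quad \Delta\eta_R=1\otimes\eta_R,\quad (\mathrm{id}\otimes\Delta)\Delta=(\Delta\otimes\mathrm{id})\Delta .$$ Here $\mathrm{id}\otimes\varepsilon$, $\varepsilon\otimes\mathrm{id}$, $\Delta\otimes\mathrm{id}$, $\mathrm{id}\otimes\Delta$ send $F\in H\hat\otimes_RH$ to $F(\cdot,1)$, $F(1,\cdot)$, $F(uv,w)$, $F(u,vw)$ respectively; these maps are continuous and have the expected values on the elements $\varphi\otimes\psi$. Moreover, $H$ admits an antipode, which makes it a commutative Hopf algebroid: there is a continuous morphism of unital $k$-algebras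 $S:H\to H$ with $S\eta_L=\eta_R$ and $S\eta_R=\eta_L$, such that the maps $\varphi\otimes\psi\mapsto\varphi\,S(\psi)$ and $\varphi\otimes\psi\mapsto S(\varphi)\,\psi$ extend to continuous multiplicative $k$-linear maps $\mu(\mathrm{id}\otimes S),\ \mu(S\otimes\mathrm{id}):H\hat\otimes_RH\to H$ satisfying $$\mu(\mathrm{id}\otimes S)\Delta=\eta_L\varepsilon,\qquad \mu(S\otimes\mathrm{id})\Delta=\eta_R\varepsilon .$$ The extensions are the canonical ones: $\mu(S\otimes\mathrm{id})(F)(u)=\sum S\big(F(\cdot,u_2)\big)(u_1)$ and $\mu(\mathrm{id}\otimes S)(F)=S\big(\mu(S\otimes\mathrm{id})(F)\big)$ for all $F\in H\hat\otimes_RH$. -/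

import Mathlib

open scoped TensorProduct

noncomputable section

namespace LieRinehartDual

/-! ### The universal enveloping algebra of a Lie-Rinehart pair `(R, L)` over `k`

A Lie-Rinehart pair is given by Mathlib's classes `LieRinehartRing R L` and
`LieRinehartAlgebra k R L`; the anchor is written `x(r) = ⁅x, r⁆` for `x : L`, `r : R`. -/

/-- The Lie algebra `R ⊕ L`; its elements are written `⟨r, x⟩`. -/
@[ext] structure SemiSum (R L : Type*) where
  fst : R
  snd : L

namespace SemiSum

variable {k R L : Type*} [CommRing k] [CommRing R] [Algebra k R] [LieRing L] [LieAlgebra k L]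

/-- As a set, and as a `k`-module, `R ⊕ L` is the product. -/
def toProd : SemiSum R L ≃ R × L where
  toFun a := (a.fst, a.snd)
  invFun a := ⟨a.1, a.2⟩

instance : AddCommGroup (SemiSum R L) := toProd.addCommGroup
instance : Module k (SemiSum R L) := toProd.module k

@[simp] lemma fst_add (a b : SemiSum R L) : (a + b).fst = a.fst + b.fst := rfl
@[simp] lemma snd_add (a b : SemiSum R L) : (a + b).snd = a.snd + b.snd := rfl
@[simp] lemma fst_zero : (0 : SemiSum R L).fst = 0 := rfl
@[simp] lemma snd_zero : (0 : SemiSum R L).snd = 0 := rfl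
@[simp] lemma fst_smul (c : k) (a : SemiSum R L) : (c • a).fst = c • a.fst := rfl
@[simp] lemma snd_smul (c : k) (a : SemiSum R L) : (c • a).snd = c • a.snd := rfl

variable [LieRingModule L R]

instance : Bracket (SemiSum R L) (SemiSum R L) where
  bracket a b := ⟨⁅a.snd, b.fst⁆ - ⁅b.snd, a.fst⁆, ⁅a.snd, b.snd⁆⟩

@[simp] lemma fst_lie (a b : SemiSum R L) : ⁅a, b⁆.fst = ⁅a.snd, b.fst⁆ - ⁅b.snd, a.fst⁆ := rfl
@[simp] lemma snd_lie (a b : SemiSum R L) : ⁅a, b⁆.snd = ⁅a.snd, b.snd⁆ := rfl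

/-- The Lie ring structure `[(r₁, x₁), (r₂, x₂)] = (x₁(r₂) - x₂(r₁), [x₁, x₂])`. -/
instance : LieRing (SemiSum R L) where
  add_lie a b c := by ext <;> simp; abel
  lie_add a b c := by ext <;> simp; abel
  lie_self a := by ext <;> simp
  leibniz_lie a b c := by ext <;> simp; abel

instance [LieModule k L R] : LieAlgebra k (SemiSum R L) where
  lie_smul c a b := by
    have h : ⁅a.snd, c • b.fst⁆ = c • ⁅a.snd, b.fst⁆ := lie_smul c a.snd b.fst
    ext <;> simp [smul_sub, h]

variable (k R L) in
/-- The inclusion `r ↦ (r, 0)`. -/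
def inl : R →ₗ[k] SemiSum R L where
  toFun r := ⟨r, 0⟩
  map_add' a b := by ext <;> simp
  map_smul' c a := by ext <;> simp

variable (k R L) in
/-- The inclusion `x ↦ (0, x)`. -/
def inr : L →ₗ[k] SemiSum R L where
  toFun x := ⟨0, x⟩
  map_add' a b := by ext <;> simp
  map_smul' c a := by ext <;> simp

end SemiSum

section Enveloping

attribute [local instance 100] LieRing.ofAssociativeRing

variable (k R L : Type*) [CommRing k] [CommRing R] [Algebra k R] [LieRing L] [LieAlgebra k L]
  [Module R L] [LieRingModule L R] [LieRinehartRing R L] [LieRinehartAlgebra k R L]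

attribute [local instance] LieRinehartAlgebra.toLieModule

/-- The class of `(r, x) ∈ R ⊕ L` in the enveloping algebra of the `k`-Lie algebra `R ⊕ L`. -/
def gen (r : R) (x : L) : UniversalEnvelopingAlgebra k (SemiSum R L) :=
  UniversalEnvelopingAlgebra.ι k (⟨r, x⟩ : SemiSum R L)

/-- The relations `r' · (r + x) = r'r + r'x`. The last relation identifies the unit of `R` with the
unit of the algebra: in the quotient of the (non-unital) subalgebra generated by `R ⊕ L` the class
of `1 ∈ R` is a two-sided unit, so that quotient is the unital algebra presented here. -/
inductive Rel : UniversalEnvelopingAlgebra k (SemiSum R L) →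
    UniversalEnvelopingAlgebra k (SemiSum R L) → Prop
  | smul (r' r : R) (x : L) : Rel (gen k R L r' 0 * gen k R L r x) (gen k R L (r' * r) (r' • x))
  | one : Rel (gen k R L 1 0) 1

/-- The universal enveloping algebra `U(R, L)` of a Lie-Rinehart pair. -/
def U : Type _ := RingQuot (Rel k R L)

instance : Ring (U k R L) := inferInstanceAs (Ring (RingQuot (Rel k R L)))
instance : Algebra k (U k R L) := inferInstanceAs (Algebra k (RingQuot (Rel k R L)))

def mk : UniversalEnvelopingAlgebra k (SemiSum R L) →ₐ[k] U k R L :=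
  RingQuot.mkAlgHom k (Rel k R L)

lemma mk_rel {a b} (h : Rel k R L a b) : mk k R L a = mk k R L b :=
  RingQuot.mkAlgHom_rel k h

/-- The canonical `k`-linear map `R ⊕ L → U`. -/
def incl : SemiSum R L →ₗ[k] U k R L :=
  (mk k R L).toLinearMap ∘ₗ (UniversalEnvelopingAlgebra.ι k).toLinearMap

/-- The canonical map `R → U`. -/
def ofR : R →ₐ[k] U k R L :=
  AlgHom.ofLinearMap (incl k R L ∘ₗ SemiSum.inl k R L)
    ((mk_rel k R L Rel.one).trans (map_one _))
    (fun a b => by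
      have := mk_rel k R L (Rel.smul a b 0)
      rw [map_mul, smul_zero] at this
      exact this.symm)

/-- The canonical map `L → U`. -/
def ofL : L →ₗ[k] U k R L := incl k R L ∘ₗ SemiSum.inr k R L

/-- The left `R`-module structure on `U`, by left multiplication: `r • u = r u`. -/
instance : Module R (U k R L) := Module.compHom _ (ofR k R L).toRingHom

variable {k R L}

lemma smul_def (r : R) (u : U k R L) : r • u = ofR k R L r * u := rfl

instance : IsScalarTower R (U k R L) (U k R L) := ⟨fun r a b => by
  simp only [smul_eq_mul, smul_def, mul_assoc]⟩

instance : IsScalarTower k R (U k R L) := ⟨fun c r u => by simp [smul_def]⟩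

instance : SMulCommClass R k (U k R L) := ⟨fun r c u => by simp [smul_def]⟩
instance : SMulCommClass k R (U k R L) := ⟨fun c r u => by simp [smul_def]⟩

/-- The Lie algebra map on `R ⊕ L` given by compatible maps on `R` and on `L`. -/
def liftLie {A : Type*} [Ring A] [Algebra k A] (f : R →ₐ[k] A) (g : L →ₗ[k] A)
    (hLL : ∀ x y, g ⁅x, y⁆ = g x * g y - g y * g x)
    (hLR : ∀ (x : L) (r : R), f ⁅x, r⁆ = g x * f r - f r * g x) : SemiSum R L →ₗ⁅k⁆ A where
  toFun a := f a.fst + g a.snd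
  map_add' a b := by simp; abel
  map_smul' c a := by simp
  map_lie' := fun {a b} => by
    have : f a.fst * f b.fst = f b.fst * f a.fst := by rw [← map_mul, mul_comm, map_mul]
    simp only [SemiSum.fst_lie, SemiSum.snd_lie, map_sub, hLR, hLL,
      LieRing.of_associative_ring_bracket, mul_add, add_mul, this]
    abel

/-- The universal property of `U`: compatible maps on `R` and on `L` extend to `U`. -/
def lift {A : Type*} [Ring A] [Algebra k A] (f : R →ₐ[k] A) (g : L →ₗ[k] A)
    (hLL : ∀ x y, g ⁅x, y⁆ = g x * g y - g y * g x)
    (hLR : ∀ (x : L) (r : R), f ⁅x, r⁆ = g x * f r - f r * g x)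
    (hRL : ∀ (r : R) (x : L), g (r • x) = f r * g x) : U k R L →ₐ[k] A :=
  RingQuot.liftAlgHom k ⟨UniversalEnvelopingAlgebra.lift k (liftLie f g hLL hLR), by
    have key : ∀ (r : R) (x : L), UniversalEnvelopingAlgebra.lift k (liftLie f g hLL hLR)
      (gen k R L r x) = f r + g x := fun r x => UniversalEnvelopingAlgebra.lift_ι_apply k _ _
    intro a b h
    cases h with
    | smul r' r x => simp [key, hRL, mul_add]
    | one => simp [key]⟩

section lift
variable {A : Type*} [Ring A] [Algebra k A] (f : R →ₐ[k] A) (g : L →ₗ[k] A)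
    (hLL : ∀ x y, g ⁅x, y⁆ = g x * g y - g y * g x)
    (hLR : ∀ (x : L) (r : R), f ⁅x, r⁆ = g x * f r - f r * g x)
    (hRL : ∀ (r : R) (x : L), g (r • x) = f r * g x)

lemma lift_incl (a : SemiSum R L) : lift f g hLL hLR hRL (incl k R L a) = f a.fst + g a.snd :=
  (RingQuot.liftAlgHom_mkAlgHom_apply _ _ _ _).trans
    (UniversalEnvelopingAlgebra.lift_ι_apply k (liftLie f g hLL hLR) a)

@[simp] lemma lift_ofR (r : R) : lift f g hLL hLR hRL (ofR k R L r) = f r := by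
  refine (lift_incl f g hLL hLR hRL ⟨r, 0⟩).trans ?_
  simp

@[simp] lemma lift_ofL (x : L) : lift f g hLL hLR hRL (ofL k R L x) = g x := by
  refine (lift_incl f g hLL hLR hRL ⟨0, x⟩).trans ?_
  simp

end lift

lemma hom_ext {A : Type*} [Ring A] [Algebra k A] {F G : U k R L →ₐ[k] A}
    (hR : ∀ r, F (ofR k R L r) = G (ofR k R L r)) (hL : ∀ x, F (ofL k R L x) = G (ofL k R L x)) :
    F = G := by
  apply RingQuot.ringQuot_ext'
  apply UniversalEnvelopingAlgebra.hom_ext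
  ext a
  have key : ∀ F : U k R L →ₐ[k] A, F (incl k R L a) =
      F (ofR k R L a.fst) + F (ofL k R L a.snd) := fun F => by
    rw [← map_add]
    congr 1
    have : a = SemiSum.inl k R L a.fst + SemiSum.inr k R L a.snd := by
      ext <;> simp [SemiSum.inl, SemiSum.inr]
    rw [this, map_add]
    simp [ofR, ofL, SemiSum.inl, SemiSum.inr]
  exact (key F).trans ((by rw [hR, hL] : _ = _).trans (key G).symm)

lemma incl_lie (a b : SemiSum R L) :
    incl k R L ⁅a, b⁆ = incl k R L a * incl k R L b - incl k R L b * incl k R L a := by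
  have h := congrArg (mk k R L) (LieHom.map_lie (UniversalEnvelopingAlgebra.ι k) a b)
  rw [LieRing.of_associative_ring_bracket, map_sub, map_mul, map_mul] at h
  exact h

lemma ofL_lie (x y : L) :
    ofL k R L ⁅x, y⁆ = ofL k R L x * ofL k R L y - ofL k R L y * ofL k R L x := by
  have h := incl_lie (k := k) (⟨0, x⟩ : SemiSum R L) ⟨0, y⟩
  rw [show ⁅(⟨0, x⟩ : SemiSum R L), (⟨0, y⟩ : SemiSum R L)⁆ = ⟨0, ⁅x, y⁆⟩ by ext <;> simp] at h
  exact h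

lemma ofR_lie (x : L) (r : R) :
    ofR k R L ⁅x, r⁆ = ofL k R L x * ofR k R L r - ofR k R L r * ofL k R L x := by
  have h := incl_lie (k := k) (⟨0, x⟩ : SemiSum R L) ⟨r, 0⟩
  rw [show ⁅(⟨0, x⟩ : SemiSum R L), (⟨r, 0⟩ : SemiSum R L)⁆ = ⟨⁅x, r⁆, 0⟩ by ext <;> simp] at h
  exact h

lemma ofL_smul (r : R) (x : L) : ofL k R L (r • x) = ofR k R L r * ofL k R L x := by
  have h := mk_rel k R L (Rel.smul r 0 x)
  rw [map_mul, mul_zero] at h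
  exact h.symm

/-- `U` is generated as an algebra by `R` and `L`. -/
lemma mem_subalgebra (S : Subalgebra k (U k R L)) (hR : ∀ r, ofR k R L r ∈ S)
    (hL : ∀ x, ofL k R L x ∈ S) (u : U k R L) : u ∈ S := by
  let F : U k R L →ₐ[k] S := lift ((ofR k R L).codRestrict S hR)
    ((ofL k R L).codRestrict (Subalgebra.toSubmodule S) hL)
    (fun x y => Subtype.ext (ofL_lie x y)) (fun x r => Subtype.ext (ofR_lie x r))
    (fun r x => Subtype.ext (ofL_smul r x))
  have h : S.val.comp F = AlgHom.id k _ := by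
    apply hom_ext
    · intro r; simp [F]
    · intro x; simp [F]; rfl
  have := DFunLike.congr_fun h u
  rw [← show S.val (F u) = u from this]
  exact (F u).2

/-! ### The left `R`-bialgebra structure of `U` -/

variable (k R L) in
/-- The action of `U` on `R`: elements of `R` act by multiplication, elements of `L` through the
anchor. -/
def act : U k R L →ₐ[k] Module.End k R :=
  lift (Algebra.lmul k R) (LieModule.toEnd k L R : L →ₗ[k] Module.End k R)
    (fun x y => by ext r; simp)
    (fun x r => by ext s; simp)
    (fun r x => by ext s; simp)

variable (k R L) in
/-- The counit (augmentation) `ε(u) = u · 1` of `U`. -/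
def counit : U k R L →ₗ[R] R where
  toFun u := act k R L u 1
  map_add' u v := by simp
  map_smul' r u := by simp [smul_def, act]

variable (k R L) in
/-- The biadditive map `(u, v) ↦ x u ⊗ v + u ⊗ x v`. -/
def diagAux (x : L) : U k R L →+ U k R L →+ U k R L ⊗[R] U k R L :=
  AddMonoidHom.mk' (fun u => AddMonoidHom.mk'
      (fun v => (ofL k R L x * u) ⊗ₜ[R] v + u ⊗ₜ[R] (ofL k R L x * v))
      (fun v w => by simp only [mul_add, TensorProduct.tmul_add]; abel))
    (fun u w => AddMonoidHom.ext fun v => by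
      simp only [AddMonoidHom.mk'_apply, AddMonoidHom.add_apply, mul_add, TensorProduct.add_tmul]
      abel)

lemma ofL_mul_smul (x : L) (r : R) (w : U k R L) :
    ofL k R L x * r • w = ⁅x, r⁆ • w + r • (ofL k R L x * w) := by
  simp only [smul_def, ofR_lie, sub_mul, mul_assoc, sub_add_cancel]

lemma diagAux_balanced (x : L) (r : R) (u v : U k R L) :
    diagAux k R L x (r • u) v = diagAux k R L x u (r • v) := by
  simp only [diagAux, AddMonoidHom.mk'_apply, ofL_mul_smul, TensorProduct.add_tmul,
    TensorProduct.tmul_add, TensorProduct.smul_tmul]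
  abel

variable (k R L) in
/-- The operator `u ⊗ v ↦ x u ⊗ v + u ⊗ x v` on `U ⊗_R U` (tensor product of left `R`-modules). -/
def diagL (x : L) : U k R L ⊗[R] U k R L →ₗ[k] U k R L ⊗[R] U k R L where
  toFun := TensorProduct.liftAddHom (diagAux k R L x) (diagAux_balanced x)
  map_add' a b := map_add _ a b
  map_smul' c a := by
    induction a with
    | zero => rw [smul_zero, map_zero, smul_zero]
    | add a b ha hb => rw [smul_add, map_add, ha, hb, map_add, smul_add]
    | tmul u v =>
      rw [RingHom.id_apply, TensorProduct.smul_tmul', TensorProduct.liftAddHom_tmul,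
        TensorProduct.liftAddHom_tmul]
      simp only [diagAux, AddMonoidHom.mk'_apply, mul_smul_comm, smul_add,
        TensorProduct.smul_tmul']

@[simp] lemma diagL_tmul (x : L) (u v : U k R L) :
    diagL k R L x (u ⊗ₜ v) = (ofL k R L x * u) ⊗ₜ[R] v + u ⊗ₜ[R] (ofL k R L x * v) := rfl

lemma end_ext {f g : Module.End k (U k R L ⊗[R] U k R L)}
    (h : ∀ u v, f (u ⊗ₜ v) = g (u ⊗ₜ v)) : f = g := by
  ext t
  induction t with
  | zero => simp
  | add a b ha hb => simp [ha, hb]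
  | tmul u v => exact h u v

variable (k R L) in
/-- The diagonal action of `U` on `U ⊗_R U`: `r ∈ R` acts by the left `R`-module structure and
`x ∈ L` by `x · (u ⊗ v) = x u ⊗ v + u ⊗ x v`. -/
def diag : U k R L →ₐ[k] Module.End k (U k R L ⊗[R] U k R L) :=
  lift (Algebra.lsmul k k (U k R L ⊗[R] U k R L))
    { toFun := diagL k R L
      map_add' := fun x y => end_ext fun u v => by
        simp only [diagL_tmul, map_add, add_mul, TensorProduct.add_tmul, TensorProduct.tmul_add,
          LinearMap.add_apply]
        abel
      map_smul' := fun c x => end_ext fun u v => by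
        simp only [diagL_tmul, map_smul, smul_mul_assoc, TensorProduct.smul_tmul',
          TensorProduct.smul_tmul, LinearMap.smul_apply, smul_add, RingHom.id_apply] }
    (fun x y => end_ext fun u v => by
      simp only [LinearMap.coe_mk, AddHom.coe_mk, diagL_tmul, ofL_lie, sub_mul, mul_assoc,
        TensorProduct.sub_tmul, TensorProduct.tmul_sub, LinearMap.sub_apply, Module.End.mul_apply,
        map_add]
      abel)
    (fun x r => end_ext fun u v => by
      simp only [LinearMap.coe_mk, AddHom.coe_mk, LinearMap.sub_apply, Module.End.mul_apply,
        Algebra.lsmul_coe, TensorProduct.smul_tmul', diagL_tmul, ofL_mul_smul, smul_add,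
        TensorProduct.add_tmul]
      abel)
    (fun r x => end_ext fun u v => by
      simp only [LinearMap.coe_mk, AddHom.coe_mk, Module.End.mul_apply, Algebra.lsmul_coe,
        diagL_tmul, ofL_smul, ← smul_def, smul_mul_assoc, smul_add, TensorProduct.smul_tmul',
        TensorProduct.smul_tmul])

variable (k R L) in
/-- The coproduct `Δ(u) = u · (1 ⊗ 1)` of `U`, so that `Δ(r) = r ⊗ 1 = 1 ⊗ r` for `r ∈ R` and
`Δ(x) = x ⊗ 1 + 1 ⊗ x` for `x ∈ L`. -/
def comul : U k R L →ₗ[R] U k R L ⊗[R] U k R L where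
  toFun u := diag k R L u (1 ⊗ₜ 1)
  map_add' u v := by simp
  map_smul' r u := by simp [smul_def, diag]

variable (k R L) in
/-- Right multiplication `u ↦ u a` on `U`. -/
def rmul (a : U k R L) : U k R L →ₗ[R] U k R L where
  toFun u := u * a
  map_add' u v := add_mul u v a
  map_smul' r u := smul_mul_assoc r u a

@[simp] lemma rmul_apply (a u : U k R L) : rmul k R L a u = u * a := rfl

lemma diag_map_rmul (u a b : U k R L) (t : U k R L ⊗[R] U k R L) :
    diag k R L u (TensorProduct.map (rmul k R L a) (rmul k R L b) t) =
      TensorProduct.map (rmul k R L a) (rmul k R L b) (diag k R L u t) := by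
  let ρ : Module.End k (U k R L ⊗[R] U k R L) :=
    (TensorProduct.map (rmul k R L a) (rmul k R L b)).restrictScalars k
  have h := mem_subalgebra ((Subalgebra.centralizer k {ρ}).comap (diag k R L)) ?_ ?_ u
  · have h' := (Subalgebra.mem_centralizer_iff k).1 h ρ rfl
    exact (DFunLike.congr_fun h' t).symm
  · intro r
    refine (Subalgebra.mem_centralizer_iff k).2 ?_
    rintro _ rfl
    exact end_ext fun u v => by simp [ρ, diag, TensorProduct.smul_tmul']
  · intro x
    refine (Subalgebra.mem_centralizer_iff k).2 ?_
    rintro _ rfl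
    exact end_ext fun u v => by simp [ρ, diag, mul_assoc]

/-- The coproduct takes values in the locus where the two right `R`-module structures of
`U ⊗_R U` coincide, and it is compatible with right multiplication by `r ∈ R`. -/
lemma comul_mul_ofR (u : U k R L) (r : R) :
    comul k R L (u * ofR k R L r) =
      TensorProduct.map (rmul k R L (ofR k R L r)) LinearMap.id (comul k R L u) := by
  have h1 : (LinearMap.id : U k R L →ₗ[R] U k R L) = rmul k R L 1 := by ext; simp
  change diag k R L (u * ofR k R L r) (1 ⊗ₜ 1) = TensorProduct.map _ _ (diag k R L u (1 ⊗ₜ 1))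
  rw [h1, ← diag_map_rmul, map_mul, Module.End.mul_apply]
  congr 1
  simp [diag, TensorProduct.smul_tmul', smul_def]

lemma comul_mul_ofR' (u : U k R L) (r : R) :
    comul k R L (u * ofR k R L r) =
      TensorProduct.map LinearMap.id (rmul k R L (ofR k R L r)) (comul k R L u) := by
  have h1 : (LinearMap.id : U k R L →ₗ[R] U k R L) = rmul k R L 1 := by ext; simp
  change diag k R L (u * ofR k R L r) (1 ⊗ₜ 1) = TensorProduct.map _ _ (diag k R L u (1 ⊗ₜ 1))
  rw [h1, ← diag_map_rmul, map_mul, Module.End.mul_apply]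
  congr 1
  have h : ofR k R L r = r • (1 : U k R L) := by simp [smul_def]
  have h' : (1 : U k R L) ⊗ₜ[R] ofR k R L r = ofR k R L r ⊗ₜ[R] 1 := by
    rw [h, TensorProduct.smul_tmul]
  simp [diag, TensorProduct.smul_tmul', smul_def, h']

/-! ### The dual `H = Hom_R(U, R)` and its completed tensor powers -/

variable (k R L) in
/-- `H = Hom_R(U, R)`, the homomorphisms of left `R`-modules. -/
abbrev Dual : Type _ := U k R L →ₗ[R] R

variable (k R L) in
/-- The completed tensor square of `H` over `R`, formed with respect to the right unit on the left
factor and the left unit on the right factor: it is `Hom_R(U ⊗_R U, R)`, where `U ⊗_R U` is the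
tensor product of `R`-bimodules (`u r ⊗ v = u ⊗ r v`), with its left `R`-module structure. Its
elements are written as balanced biadditive functions `F(u, v)` which are left `R`-linear
in `u`. -/
def Dual₂ : Submodule k (U k R L →ₗ[k] U k R L →ₗ[k] R) where
  carrier := {F | (∀ (r : R) u v, F (r • u) v = r * F u v) ∧
    ∀ u (r : R) v, F (u * ofR k R L r) v = F u (r • v)}
  add_mem' := fun ⟨h1, h2⟩ ⟨h3, h4⟩ => ⟨fun r u v => by simp [h1, h3, mul_add],
    fun u r v => by simp [h2, h4]⟩
  zero_mem' := ⟨by simp, by simp⟩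
  smul_mem' c F := fun ⟨h1, h2⟩ => ⟨fun r u v => by simp [h1], fun u r v => by simp [h2]⟩

variable (k R L) in
/-- The completed tensor cube of `H` over `R`, that is, `Hom_R(U ⊗_R U ⊗_R U, R)`. -/
def Dual₃ : Submodule k (U k R L →ₗ[k] U k R L →ₗ[k] U k R L →ₗ[k] R) where
  carrier := {F | (∀ (r : R) u v w, F (r • u) v w = r * F u v w) ∧
    (∀ u (r : R) v w, F (u * ofR k R L r) v w = F u (r • v) w) ∧
    ∀ u v (r : R) w, F u (v * ofR k R L r) w = F u v (r • w)}
  add_mem' := fun ⟨h1, h2, h3⟩ ⟨h4, h5, h6⟩ => ⟨fun r u v w => by simp [h1, h4, mul_add],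
    fun u r v w => by simp [h2, h5], fun u v r w => by simp [h3, h6]⟩
  zero_mem' := ⟨by simp, by simp, by simp⟩
  smul_mem' c F := fun ⟨h1, h2, h3⟩ => ⟨fun r u v w => by simp [h1],
    fun u r v w => by simp [h2], fun u v r w => by simp [h3]⟩

set_option maxSynthPendingDepth 5 in
instance : AddCommGroup (Dual₃ k R L) := inferInstance
set_option maxSynthPendingDepth 5 in
instance : Module k (Dual₃ k R L) := inferInstance

/-- The topology of pointwise convergence on `H`. -/
instance [TopologicalSpace R] : TopologicalSpace (Dual k R L) :=
  TopologicalSpace.induced (fun φ (u : U k R L) => φ u) inferInstance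

/-- The topology of pointwise convergence on the completed tensor square. -/
instance [TopologicalSpace R] : TopologicalSpace (Dual₂ k R L) :=
  TopologicalSpace.induced (fun F (p : U k R L × U k R L) => F.1 p.1 p.2) inferInstance

/-- The topology of pointwise convergence on the completed tensor cube. -/
instance [TopologicalSpace R] : TopologicalSpace (Dual₃ k R L) :=
  TopologicalSpace.induced
    (fun F (p : U k R L × U k R L × U k R L) => F.1 p.1 p.2.1 p.2.2) inferInstance

variable (k R L) in
/-- The product of `H`, dual to the coproduct of `U`: `(φψ)(u) = ∑ φ(u₁) ψ(u₂)` where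
`Δ(u) = ∑ u₁ ⊗ u₂`. -/
def dualMul : Dual k R L →ₗ[k] Dual k R L →ₗ[k] Dual k R L :=
  LinearMap.mk₂ k (fun φ ψ => LinearMap.mul' R R ∘ₗ TensorProduct.map φ ψ ∘ₗ comul k R L)
    (fun φ φ' ψ => by
      rw [TensorProduct.map_add_left, LinearMap.add_comp, LinearMap.comp_add])
    (fun c φ ψ => by
      ext u
      have h : ∀ t, LinearMap.mul' R R (TensorProduct.map (c • φ) ψ t) =
          c • LinearMap.mul' R R (TensorProduct.map φ ψ t) := fun t => by
        induction t with
        | zero => simp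
        | add a b ha hb => simp only [map_add, ha, hb, smul_add]
        | tmul a b => simp
      exact h _)
    (fun φ ψ ψ' => by
      rw [TensorProduct.map_add_right, LinearMap.add_comp, LinearMap.comp_add])
    (fun c φ ψ => by
      ext u
      have h : ∀ t, LinearMap.mul' R R (TensorProduct.map φ (c • ψ) t) =
          c • LinearMap.mul' R R (TensorProduct.map φ ψ t) := fun t => by
        induction t with
        | zero => simp
        | add a b ha hb => simp only [map_add, ha, hb, smul_add]
        | tmul a b => simp
      exact h _)

lemma dualMul_apply (φ ψ : Dual k R L) (u : U k R L) :
    dualMul k R L φ ψ u = LinearMap.mul' R R (TensorProduct.map φ ψ (comul k R L u)) := rfl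

lemma dualMul_rmul_left (φ ψ : Dual k R L) (r : R) (u : U k R L) :
    dualMul k R L (φ ∘ₗ rmul k R L (ofR k R L r)) ψ u = dualMul k R L φ ψ (u * ofR k R L r) := by
  rw [dualMul_apply, dualMul_apply, comul_mul_ofR, ← LinearMap.comp_apply (TensorProduct.map φ ψ),
    ← TensorProduct.map_comp, LinearMap.comp_id]

lemma dualMul_rmul_right (φ ψ : Dual k R L) (r : R) (u : U k R L) :
    dualMul k R L φ (ψ ∘ₗ rmul k R L (ofR k R L r)) u = dualMul k R L φ ψ (u * ofR k R L r) := by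
  rw [dualMul_apply, dualMul_apply, comul_mul_ofR', ← LinearMap.comp_apply (TensorProduct.map φ ψ),
    ← TensorProduct.map_comp, LinearMap.comp_id]

/-- For `F` in the completed tensor square and `v ∈ U`, the functional `u ↦ F(u, v)` of `H`. -/
def slice (F : Dual₂ k R L) : U k R L →ₗ[k] Dual k R L where
  toFun v :=
    { toFun := fun u => F.1 u v
      map_add' := by simp
      map_smul' := fun r u => F.2.1 r u v }
  map_add' v w := by ext u; simp
  map_smul' c v := by ext u; simp

@[simp] lemma slice_apply (F : Dual₂ k R L) (u v : U k R L) : slice F v u = F.1 u v := rfl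

lemma slice_smul (F : Dual₂ k R L) (r : R) (v : U k R L) :
    slice F (r • v) = slice F v ∘ₗ rmul k R L (ofR k R L r) := by
  ext u; exact (F.2.2 u r v).symm

lemma slice_balanced (F G : Dual₂ k R L) (r : R) (v w : U k R L) :
    dualMul k R L (slice F (r • v)) (slice G w) = dualMul k R L (slice F v) (slice G (r • w)) := by
  ext u
  rw [slice_smul, slice_smul, dualMul_rmul_left, dualMul_rmul_right]

/-- The map `v ⊗ w ↦ F(-, v) G(-, w)` from `U ⊗_R U` (left modules) to `H`. -/
def sliceMul (F G : Dual₂ k R L) : U k R L ⊗[R] U k R L →+ Dual k R L :=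
  TensorProduct.liftAddHom
    (AddMonoidHom.mk' (fun v => AddMonoidHom.mk'
        (fun w => dualMul k R L (slice F v) (slice G w)) (fun w w' => by simp))
      (fun v v' => by ext w : 1; simp))
    (slice_balanced F G)

@[simp] lemma sliceMul_tmul (F G : Dual₂ k R L) (v w : U k R L) :
    sliceMul F G (v ⊗ₜ w) = dualMul k R L (slice F v) (slice G w) := rfl

lemma sliceMul_smul (F G : Dual₂ k R L) (r : R) (t : U k R L ⊗[R] U k R L) (u : U k R L) :
    sliceMul F G (r • t) u = sliceMul F G t (u * ofR k R L r) := by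
  induction t with
  | zero => simp
  | add a b ha hb => simp only [smul_add, map_add, LinearMap.add_apply, ha, hb]
  | tmul v w => rw [TensorProduct.smul_tmul', sliceMul_tmul, sliceMul_tmul, slice_smul,
      dualMul_rmul_left]

lemma sliceMul_smul' (F G : Dual₂ k R L) (c : k) (t : U k R L ⊗[R] U k R L) :
    sliceMul F G (c • t) = c • sliceMul F G t := by
  induction t with
  | zero => simp
  | add a b ha hb => simp only [smul_add, map_add, ha, hb]
  | tmul v w => rw [TensorProduct.smul_tmul', sliceMul_tmul, sliceMul_tmul, map_smul, map_smul,
      LinearMap.smul_apply]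

lemma comul_smul (c : k) (u : U k R L) : comul k R L (c • u) = c • comul k R L u := by
  simp [comul]

/-- The product `(FG)(u, v) = ∑ F(u₁, v₁) G(u₂, v₂)` of two elements of the completed tensor
square. -/
def dualMul₂Fun (F G : Dual₂ k R L) : Dual₂ k R L :=
  ⟨LinearMap.mk₂ k (fun u v => sliceMul F G (comul k R L v) u)
      (fun u u' v => by simp)
      (fun c u v => by simp)
      (fun u v v' => by simp)
      (fun c u v => by rw [comul_smul, sliceMul_smul', LinearMap.smul_apply]),
    fun r u v => by simp, fun u r v => by simp [sliceMul_smul]⟩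

lemma dualMul₂Fun_apply (F G : Dual₂ k R L) (u v : U k R L) :
    (dualMul₂Fun F G).1 u v = sliceMul F G (comul k R L v) u := rfl

lemma slice_add (F F' : Dual₂ k R L) (v : U k R L) : slice (F + F') v = slice F v + slice F' v :=
  rfl

lemma slice_smul' (c : k) (F : Dual₂ k R L) (v : U k R L) : slice (c • F) v = c • slice F v := rfl

lemma sliceMul_ext {f g : U k R L ⊗[R] U k R L →+ Dual k R L}
    (h : ∀ v w, f (v ⊗ₜ w) = g (v ⊗ₜ w)) : f = g := by
  ext t : 1
  induction t with
  | zero => simp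
  | add a b ha hb => simp only [map_add, ha, hb]
  | tmul v w => exact h v w

variable (k R L) in
/-- The product of the completed tensor square, as a `k`-bilinear map. -/
def dualMul₂ : Dual₂ k R L →ₗ[k] Dual₂ k R L →ₗ[k] Dual₂ k R L :=
  LinearMap.mk₂ k dualMul₂Fun
    (fun F F' G => by
      have h : sliceMul (F + F') G = sliceMul F G + sliceMul F' G :=
        sliceMul_ext fun v w => by simp [slice_add]
      ext u v
      simp [dualMul₂Fun_apply, h])
    (fun c F G => by
      have h : sliceMul (c • F) G = c • sliceMul F G :=
        sliceMul_ext fun v w => by simp [slice_smul']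
      ext u v
      simp [dualMul₂Fun_apply, h])
    (fun F G G' => by
      have h : sliceMul F (G + G') = sliceMul F G + sliceMul F G' :=
        sliceMul_ext fun v w => by simp [slice_add]
      ext u v
      simp [dualMul₂Fun_apply, h])
    (fun c F G => by
      have h : sliceMul F (c • G) = c • sliceMul F G :=
        sliceMul_ext fun v w => by simp [slice_smul']
      ext u v
      simp [dualMul₂Fun_apply, h])

variable (k R L) in
/-- The unit of `H`: the counit `ε` of `U`. -/
def dualOne : Dual k R L := counit k R L

variable (k R L) in
/-- The left unit: `η_L(r)(u) = r ε(u)`. -/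
def etaL : R →ₗ[k] Dual k R L where
  toFun r := r • counit k R L
  map_add' r s := add_smul r s _
  map_smul' c r := smul_assoc c r _

variable (k R L) in
/-- The right unit: `η_R(r)(u) = u · r`, which is `ε(u r)`. -/
def etaR : R →ₗ[k] Dual k R L where
  toFun r :=
    { toFun := fun u => act k R L u r
      map_add' := by simp
      map_smul' := fun s u => by simp [smul_def, act] }
  map_add' r s := by ext u; exact map_add (act k R L u) r s
  map_smul' c r := by ext u; exact map_smul (act k R L u) c r

variable (k R L) in
/-- The counit of `H`, dual to the unit of `U`: `φ ↦ φ(1)`. -/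
def dualCounit : Dual k R L →ₗ[k] R where
  toFun φ := φ 1
  map_add' _ _ := rfl
  map_smul' _ _ := rfl

variable (k R L) in
/-- The coproduct of `H`, dual to the product of `U`: `Δ(φ)(u, v) = φ(u v)`. -/
def dualComul : Dual k R L →ₗ[k] Dual₂ k R L where
  toFun φ := ⟨(LinearMap.mul k (U k R L)).compr₂ (φ.restrictScalars k),
    fun r u v => by simp [smul_mul_assoc], fun u r v => by simp [smul_def, mul_assoc]⟩
  map_add' _ _ := rfl
  map_smul' _ _ := rfl

variable (k R L) in
/-- The canonical map `H × H → H ⊗̂_R H`: `(φ ⊗ ψ)(u, v) = φ(u ψ(v))`. -/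
def tmul : Dual k R L →ₗ[k] Dual k R L →ₗ[k] Dual₂ k R L :=
  LinearMap.mk₂ k
    (fun φ ψ => ⟨LinearMap.mk₂ k (fun u v => φ (u * ofR k R L (ψ v)))
        (fun u u' v => by rw [add_mul, map_add])
        (fun c u v => by rw [smul_mul_assoc, LinearMap.map_smul_of_tower])
        (fun u v v' => by rw [map_add, map_add, mul_add, map_add])
        (fun c u v => by
          rw [LinearMap.map_smul_of_tower, map_smul, mul_smul_comm, LinearMap.map_smul_of_tower]),
      fun r u v => by simp [smul_mul_assoc], fun u r v => by simp [mul_assoc]⟩)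
    (fun φ φ' ψ => rfl)
    (fun c φ ψ => rfl)
    (fun φ ψ ψ' => by ext u v; simp [mul_add])
    (fun c φ ψ => by ext u v; simp [LinearMap.map_smul_of_tower])

/-- A trilinear function as an iterated linear map. -/
def mk₃ (f : U k R L → U k R L →ₗ[k] U k R L →ₗ[k] R)
    (h1 : ∀ u u' v w, f (u + u') v w = f u v w + f u' v w)
    (h2 : ∀ (c : k) u v w, f (c • u) v w = c • f u v w) :
    U k R L →ₗ[k] U k R L →ₗ[k] U k R L →ₗ[k] R where
  toFun := f
  map_add' u u' := by ext v w; exact h1 u u' v w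
  map_smul' c u := by ext v w; exact h2 c u v w

/-- The canonical map `(H ⊗̂_R H) × H → H ⊗̂_R H ⊗̂_R H`: `(F ⊗ χ)(u, v, w) = F(u, v χ(w))`. -/
def tmul₂₁ (F : Dual₂ k R L) (χ : Dual k R L) : Dual₃ k R L :=
  ⟨mk₃ (fun u => LinearMap.mk₂ k (fun v w => F.1 u (v * ofR k R L (χ w)))
      (fun v v' w => by rw [add_mul, map_add])
      (fun c v w => by rw [smul_mul_assoc, map_smul])
      (fun v w w' => by rw [map_add, map_add, mul_add, map_add])
      (fun c v w => by rw [LinearMap.map_smul_of_tower, map_smul, mul_smul_comm, map_smul]))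
    (fun u u' v w => by simp) (fun c u v w => by simp),
   fun r u v w => F.2.1 r u _,
   fun u r v w => by
    change F.1 (u * ofR k R L r) (v * ofR k R L (χ w)) = F.1 u (r • v * ofR k R L (χ w))
    rw [F.2.2, smul_mul_assoc],
   fun u v r w => by simp [mk₃, mul_assoc]⟩

/-- The canonical map `H × (H ⊗̂_R H) → H ⊗̂_R H ⊗̂_R H`: `(φ ⊗ G)(u, v, w) = φ(u G(v, w))`. -/
def tmul₁₂ (φ : Dual k R L) (G : Dual₂ k R L) : Dual₃ k R L :=
  ⟨mk₃ (fun u => LinearMap.mk₂ k (fun v w => φ (u * ofR k R L (G.1 v w)))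
      (fun v v' w => by simp [mul_add])
      (fun c v w => by
        rw [map_smul, LinearMap.smul_apply, map_smul, mul_smul_comm, LinearMap.map_smul_of_tower])
      (fun v w w' => by simp [mul_add])
      (fun c v w => by rw [map_smul, map_smul, mul_smul_comm, LinearMap.map_smul_of_tower]))
    (fun u u' v w => by simp [add_mul])
    (fun c u v w => by
      simp only [LinearMap.mk₂_apply, smul_mul_assoc, LinearMap.map_smul_of_tower]),
   fun r u v w => by simp [mk₃, smul_mul_assoc],
   fun u r v w => by
    change φ (u * ofR k R L r * ofR k R L (G.1 v w)) = φ (u * ofR k R L (G.1 (r • v) w))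
    rw [G.2.1, mul_assoc, ← map_mul],
   fun u v r w => by
    change φ (u * ofR k R L (G.1 (v * ofR k R L r) w)) = φ (u * ofR k R L (G.1 v (r • w)))
    rw [G.2.2]⟩

variable (k R L) in
/-- The map `id ⊗ ε : H ⊗̂_R H → H`, `F ↦ F(-, 1)`. -/
def idCounit : Dual₂ k R L →ₗ[k] Dual k R L where
  toFun F := slice F 1
  map_add' _ _ := rfl
  map_smul' _ _ := rfl

variable (k R L) in
/-- The map `ε ⊗ id : H ⊗̂_R H → H`, `F ↦ F(1, -)`. -/
def counitId : Dual₂ k R L →ₗ[k] Dual k R L where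
  toFun F :=
    { toFun := fun v => F.1 1 v
      map_add' := by simp
      map_smul' := fun r v => by
        have h : (1 : U k R L) * ofR k R L r = r • 1 := by simp [smul_def]
        rw [← F.2.2, h, F.2.1]
        rfl }
  map_add' _ _ := rfl
  map_smul' _ _ := rfl

variable (k R L) in
/-- The map `Δ ⊗ id : H ⊗̂_R H → H ⊗̂_R H ⊗̂_R H`, `F ↦ ((u, v, w) ↦ F(u v, w))`. -/
def comulId : Dual₂ k R L →ₗ[k] Dual₃ k R L where
  toFun F := ⟨mk₃ (fun u => F.1 ∘ₗ LinearMap.mul k (U k R L) u)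
      (fun u u' v w => by simp) (fun c u v w => by simp),
    fun r u v w => by simpa [mk₃, smul_mul_assoc] using F.2.1 r (u * v) w,
    fun u r v w => by simp [mk₃, smul_def, mul_assoc],
    fun u v r w => by simpa [mk₃, mul_assoc] using F.2.2 (u * v) r w⟩
  map_add' _ _ := rfl
  map_smul' _ _ := rfl

variable (k R L) in
/-- The map `id ⊗ Δ : H ⊗̂_R H → H ⊗̂_R H ⊗̂_R H`, `F ↦ ((u, v, w) ↦ F(u, v w))`. -/
def idComul : Dual₂ k R L →ₗ[k] Dual₃ k R L where
  toFun F := ⟨mk₃ (fun u => (LinearMap.mul k (U k R L)).compr₂ (F.1 u))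
      (fun u u' v w => by simp) (fun c u v w => by simp),
    fun r u v w => F.2.1 r u (v * w),
    fun u r v w => by simpa [mk₃, smul_mul_assoc] using F.2.2 u r (v * w),
    fun u v r w => by simp [mk₃, smul_def, mul_assoc]⟩
  map_add' _ _ := rfl
  map_smul' _ _ := rfl

end Enveloping

/-! ### Commutative bialgebroids and Hopf algebroids -/

/-- The data of a topological commutative bialgebroid `(R, H)` over `k`, where `H₂` and `H₃` are the
completed tensor powers `H ⊗̂_R H` and `H ⊗̂_R H ⊗̂_R H` formed with respect to the right unit on the
left factor and the left unit on the right factor, together with their canonical maps. -/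
structure BialgebroidData (k R H H₂ H₃ : Type*) [CommRing k] [CommRing R] [Algebra k R]
    [AddCommGroup H] [Module k H] [AddCommGroup H₂] [Module k H₂] [AddCommGroup H₃]
    [Module k H₃] where
  /-- the product of `H` -/
  mul : H →ₗ[k] H →ₗ[k] H
  /-- the unit element of `H` -/
  one : H
  /-- the left unit (source map) -/
  ηL : R →ₗ[k] H
  /-- the right unit (target map) -/
  ηR : R →ₗ[k] H
  /-- the comultiplication -/
  Δ : H →ₗ[k] H₂
  /-- the counit -/
  ε : H →ₗ[k] R
  /-- `(φ, ψ) ↦ φ ⊗ ψ` -/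
  tmul : H →ₗ[k] H →ₗ[k] H₂
  /-- the product of `H ⊗̂_R H` -/
  mul₂ : H₂ →ₗ[k] H₂ →ₗ[k] H₂
  /-- `(F, χ) ↦ F ⊗ χ` -/
  tmul₂₁ : H₂ → H → H₃
  /-- `(φ, G) ↦ φ ⊗ G` -/
  tmul₁₂ : H → H₂ → H₃
  /-- `id ⊗ ε` -/
  idε : H₂ →ₗ[k] H
  /-- `ε ⊗ id` -/
  εid : H₂ →ₗ[k] H
  /-- `Δ ⊗ id` -/
  Δid : H₂ →ₗ[k] H₃
  /-- `id ⊗ Δ` -/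
  idΔ : H₂ →ₗ[k] H₃

namespace BialgebroidData

variable {k R H H₂ H₃ : Type*} [CommRing k] [CommRing R] [Algebra k R]
  [AddCommGroup H] [Module k H] [AddCommGroup H₂] [Module k H₂] [AddCommGroup H₃] [Module k H₃]
  [TopologicalSpace R] [TopologicalSpace H] [TopologicalSpace H₂] [TopologicalSpace H₃]

/-- The axioms of a topological, unital and counital commutative bialgebroid. -/
structure IsBialgebroid (B : BialgebroidData k R H H₂ H₃) : Prop where
  -- `H` is a topological commutative associative unital `k`-algebra
  mul_comm : ∀ φ ψ, B.mul φ ψ = B.mul ψ φ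
  mul_assoc : ∀ φ ψ χ, B.mul (B.mul φ ψ) χ = B.mul φ (B.mul ψ χ)
  one_mul : ∀ φ, B.mul B.one φ = φ
  continuous_add : Continuous fun p : H × H => p.1 + p.2
  continuous_mul : Continuous fun p : H × H => B.mul p.1 p.2
  -- so is its completed tensor square, with unit `1 ⊗ 1`
  mul₂_comm : ∀ F G, B.mul₂ F G = B.mul₂ G F
  mul₂_assoc : ∀ F G K, B.mul₂ (B.mul₂ F G) K = B.mul₂ F (B.mul₂ G K)
  one_mul₂ : ∀ F, B.mul₂ (B.tmul B.one B.one) F = F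
  continuous_add₂ : Continuous fun p : H₂ × H₂ => p.1 + p.2
  continuous_mul₂ : Continuous fun p : H₂ × H₂ => B.mul₂ p.1 p.2
  -- the canonical maps into the completed tensor powers
  tmul_balanced : ∀ φ r ψ, B.tmul (B.mul φ (B.ηR r)) ψ = B.tmul φ (B.mul (B.ηL r) ψ)
  tmul_mul : ∀ φ ψ φ' ψ', B.mul₂ (B.tmul φ ψ) (B.tmul φ' ψ') = B.tmul (B.mul φ φ') (B.mul ψ ψ')
  continuous_tmul : Continuous fun p : H × H => B.tmul p.1 p.2
  tmul_assoc : ∀ φ ψ χ, B.tmul₂₁ (B.tmul φ ψ) χ = B.tmul₁₂ φ (B.tmul ψ χ)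
  -- the maps `id ⊗ ε`, `ε ⊗ id`, `Δ ⊗ id`, `id ⊗ Δ` are continuous extensions
  idε_tmul : ∀ φ ψ, B.idε (B.tmul φ ψ) = B.mul φ (B.ηR (B.ε ψ))
  εid_tmul : ∀ φ ψ, B.εid (B.tmul φ ψ) = B.mul (B.ηL (B.ε φ)) ψ
  Δid_tmul : ∀ φ ψ, B.Δid (B.tmul φ ψ) = B.tmul₂₁ (B.Δ φ) ψ
  idΔ_tmul : ∀ φ ψ, B.idΔ (B.tmul φ ψ) = B.tmul₁₂ φ (B.Δ ψ)
  continuous_idε : Continuous B.idε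
  continuous_εid : Continuous B.εid
  continuous_Δid : Continuous B.Δid
  continuous_idΔ : Continuous B.idΔ
  -- the units and the counit are continuous morphisms of unital algebras
  ηL_one : B.ηL 1 = B.one
  ηL_mul : ∀ r s, B.ηL (r * s) = B.mul (B.ηL r) (B.ηL s)
  continuous_ηL : Continuous B.ηL
  ηR_one : B.ηR 1 = B.one
  ηR_mul : ∀ r s, B.ηR (r * s) = B.mul (B.ηR r) (B.ηR s)
  continuous_ηR : Continuous B.ηR
  ε_one : B.ε B.one = 1
  ε_mul : ∀ φ ψ, B.ε (B.mul φ ψ) = B.ε φ * B.ε ψ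
  continuous_ε : Continuous B.ε
  -- counit laws
  idε_Δ : ∀ φ, B.idε (B.Δ φ) = φ
  εid_Δ : ∀ φ, B.εid (B.Δ φ) = φ
  ε_ηL : ∀ r, B.ε (B.ηL r) = r
  ε_ηR : ∀ r, B.ε (B.ηR r) = r
  -- source and target laws
  Δ_ηL : ∀ r, B.Δ (B.ηL r) = B.tmul (B.ηL r) B.one
  Δ_ηR : ∀ r, B.Δ (B.ηR r) = B.tmul B.one (B.ηR r)
  -- coassociativity
  coassoc : ∀ φ, B.idΔ (B.Δ φ) = B.Δid (B.Δ φ)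
  -- the comultiplication is a continuous morphism of unital algebras
  Δ_one : B.Δ B.one = B.tmul B.one B.one
  Δ_mul : ∀ φ ψ, B.Δ (B.mul φ ψ) = B.mul₂ (B.Δ φ) (B.Δ ψ)
  continuous_Δ : Continuous B.Δ

/-- `S` is an antipode of the bialgebroid: a continuous endomorphism of the algebra `H`, exchanging
the two units, such that the maps `μ ∘ (id ⊗ S)` and `μ ∘ (S ⊗ id)` descend to continuous algebra
morphisms `idS` and `Sid` on `H ⊗̂_R H` and satisfy the antipode identities. -/
structure IsAntipode (B : BialgebroidData k R H H₂ H₃) (S : H →ₗ[k] H) (idS Sid : H₂ →ₗ[k] H) :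
    Prop where
  S_one : S B.one = B.one
  S_mul : ∀ φ ψ, S (B.mul φ ψ) = B.mul (S φ) (S ψ)
  continuous_S : Continuous S
  S_ηL : ∀ r, S (B.ηL r) = B.ηR r
  S_ηR : ∀ r, S (B.ηR r) = B.ηL r
  idS_tmul : ∀ φ ψ, idS (B.tmul φ ψ) = B.mul φ (S ψ)
  Sid_tmul : ∀ φ ψ, Sid (B.tmul φ ψ) = B.mul (S φ) ψ
  idS_mul : ∀ F G, idS (B.mul₂ F G) = B.mul (idS F) (idS G)
  Sid_mul : ∀ F G, Sid (B.mul₂ F G) = B.mul (Sid F) (Sid G)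
  continuous_idS : Continuous idS
  continuous_Sid : Continuous Sid
  idS_Δ : ∀ φ, idS (B.Δ φ) = B.ηL (B.ε φ)
  Sid_Δ : ∀ φ, Sid (B.Δ φ) = B.ηR (B.ε φ)

end BialgebroidData

variable (k R L : Type*) [CommRing k] [CommRing R] [Algebra k R] [LieRing L] [LieAlgebra k L]
  [Module R L] [LieRingModule L R] [LieRinehartRing R L] [LieRinehartAlgebra k R L]

/-- The canonical structure maps on `H = Hom_R(U, R)`, dual to those of `U`. -/
def dualData : BialgebroidData k R (Dual k R L) (Dual₂ k R L) (Dual₃ k R L) where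
  mul := dualMul k R L
  one := dualOne k R L
  ηL := etaL k R L
  ηR := etaR k R L
  Δ := dualComul k R L
  ε := dualCounit k R L
  tmul := tmul k R L
  mul₂ := dualMul₂ k R L
  tmul₂₁ := tmul₂₁
  tmul₁₂ := tmul₁₂
  idε := idCounit k R L
  εid := counitId k R L
  Δid := comulId k R L
  idΔ := idComul k R L

end LieRinehartDual

end

noncomputable section

namespace LieRinehartDual

/-!
`U` is a cocommutative coalgebra over `R`, so `H = Hom_R(U, R)` is a commutative convolution
algebra, and the flat connection `(∇ₓ φ)(u) = x(φ(u)) - φ(x u)` makes it a `U`-module algebra. The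
antipode is `S(φ)(u) = (u · φ)(1)`; from `(u · S(φ))(v) = (v · φ)(u)` it is involutive and turns
right translations into the action of `U`. Therefore `F ↦ (v ↦ S(F(-, v)))` embeds `H ⊗̂_R H` in the
convolution algebra `Hom_R(U, H)`. Under this embedding `Δ(φ)` becomes the orbit map of `S(φ)`,
which is multiplicative because `H` is a module algebra, and `μ(S ⊗ id)` becomes the restriction of
functions on `U ⊗_R U` along the coproduct of `U`, a morphism of coalgebras.
-/

open WithConv

section LeibnizTensor

variable {R M N : Type*} [CommSemiring R] [AddCommMonoid M] [Module R M] [AddCommMonoid N]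
  [Module R N]

/-- The operator `D ⊗ 1 + 1 ⊗ E` on `M ⊗[R] N`, for additive operators `D` and `E` which are not
`R`-linear but satisfy the Leibniz rule with respect to the same map `δ : R → R`. -/
def leibnizTensor (δ : R → R) (D : M →+ M) (E : N →+ N)
    (hD : ∀ (r : R) (m : M), D (r • m) = δ r • m + r • D m)
    (hE : ∀ (r : R) (n : N), E (r • n) = δ r • n + r • E n) : M ⊗[R] N →+ M ⊗[R] N :=
  TensorProduct.liftAddHom
    { toFun := fun m =>
        { toFun := fun n => D m ⊗ₜ[R] n + m ⊗ₜ[R] E n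
          map_zero' := by simp
          map_add' := fun n n' => by
            simp only [map_add, TensorProduct.tmul_add]
            abel }
      map_zero' := AddMonoidHom.ext fun n => by simp
      map_add' := fun m m' => AddMonoidHom.ext fun n => by
        simp only [map_add, TensorProduct.add_tmul, AddMonoidHom.coe_mk, ZeroHom.coe_mk,
          AddMonoidHom.add_apply]
        abel }
    fun r m n => by
      simp only [AddMonoidHom.coe_mk, ZeroHom.coe_mk, hD, hE, TensorProduct.add_tmul,
        TensorProduct.tmul_add, TensorProduct.smul_tmul]
      abel

variable {δ : R → R} {D : M →+ M} {E : N →+ N}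
  {hD : ∀ (r : R) (m : M), D (r • m) = δ r • m + r • D m}
  {hE : ∀ (r : R) (n : N), E (r • n) = δ r • n + r • E n}

@[simp] lemma leibnizTensor_tmul (m : M) (n : N) :
    leibnizTensor δ D E hD hE (m ⊗ₜ n) = D m ⊗ₜ n + m ⊗ₜ E n := rfl

end LeibnizTensor

section ConvUncurry

variable {R C D A : Type*} [CommSemiring R] [AddCommMonoid C] [Module R C] [AddCommMonoid D]
  [Module R D]

/-- The uncurrying `Hom(D, Hom(C, A)) → Hom(C ⊗ D, A)`, as a map between convolution algebras. -/
def convUncurry [AddCommMonoid A] [Module R A] (f : WithConv (D →ₗ[R] WithConv (C →ₗ[R] A))) :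
    WithConv (C ⊗[R] D →ₗ[R] A) :=
  toConv (TensorProduct.lift ((WithConv.linearEquiv R (C →ₗ[R] A)).toLinearMap ∘ₗ f.ofConv).flip)

@[simp] lemma convUncurry_tmul [AddCommMonoid A] [Module R A]
    (f : WithConv (D →ₗ[R] WithConv (C →ₗ[R] A))) (c : C) (d : D) :
    convUncurry f (c ⊗ₜ d) = f d c := rfl

lemma convUncurry_mul [NonUnitalNonAssocSemiring A] [Module R A] [SMulCommClass R A A]
    [IsScalarTower R A A] [CoalgebraStruct R C] [CoalgebraStruct R D]
    (f g : WithConv (D →ₗ[R] WithConv (C →ₗ[R] A))) :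
    convUncurry (f * g) = convUncurry f * convUncurry g := by
  refine WithConv.ext (TensorProduct.ext' fun c d => ?_)
  change (f * g) d c = (convUncurry f * convUncurry g) (c ⊗ₜ d)
  have hc := Coalgebra.Repr.arbitrary R c
  have hd := Coalgebra.Repr.arbitrary R d
  rw [hd.convMul_apply, LinearMap.convMul_apply, TensorProduct.comul_tmul, ← hc.eq, ← hd.eq]
  simp [TensorProduct.sum_tmul, TensorProduct.tmul_sum, hc.convMul_apply]

end ConvUncurry

lemma continuous_apply_of_tmul {R M N A X F : Type*} [CommSemiring R] [AddCommMonoid M]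
    [Module R M] [AddCommMonoid N] [Module R N] [AddCommMonoid A] [TopologicalSpace A]
    [ContinuousAdd A] [TopologicalSpace X] [FunLike F (M ⊗[R] N) A]
    [AddMonoidHomClass F (M ⊗[R] N) A] {f : X → F}
    (h : ∀ m n, Continuous fun a => f a (m ⊗ₜ[R] n)) (t : M ⊗[R] N) :
    Continuous fun a => f a t := by
  induction t with
  | zero => simpa only [map_zero] using continuous_const
  | add s t hs ht => simpa only [map_add] using! hs.add ht
  | tmul m n => exact h m n

attribute [local instance] LieRinehartAlgebra.toLieModule

variable {k R L : Type*} [CommRing k] [CommRing R] [Algebra k R] [LieRing L] [LieAlgebra k L]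
  [Module R L] [LieRingModule L R] [LieRinehartRing R L] [LieRinehartAlgebra k R L]

/-! ### The coalgebra `U` -/

theorem left_induction {P : U k R L → Prop} (one : P 1) (add : ∀ u v, P u → P v → P (u + v))
    (smul : ∀ (r : R) u, P u → P (r • u)) (ofL_mul : ∀ (x : L) u, P u → P (ofL k R L x * u))
    (u : U k R L) : P u := by
  let S : Subalgebra k (U k R L) :=
    { carrier := {a | ∀ v, P v → P (a * v)}
      mul_mem' := fun {a b} ha hb v hv => by rw [mul_assoc]; exact ha _ (hb _ hv)
      add_mem' := fun {a b} ha hb v hv => by rw [add_mul]; exact add _ _ (ha _ hv) (hb _ hv)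
      algebraMap_mem' := fun c v hv => by
        have h := smul (algebraMap k R c) v hv
        rwa [smul_def, AlgHom.commutes] at h }
  have hu : u ∈ S := mem_subalgebra S (fun r v hv => smul r v hv) (fun x v hv => ofL_mul x v hv) u
  simpa using hu 1 one

@[simp] lemma comul_one : comul k R L 1 = 1 ⊗ₜ 1 :=
  LinearMap.congr_fun (map_one (diag k R L)) (1 ⊗ₜ 1)

lemma comul_mul (u v : U k R L) : comul k R L (u * v) = diag k R L u (comul k R L v) :=
  LinearMap.congr_fun (map_mul (diag k R L) u v) (1 ⊗ₜ 1)

lemma comul_ofL_mul (x : L) (u : U k R L) :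
    comul k R L (ofL k R L x * u) = diagL k R L x (comul k R L u) := by
  rw [comul_mul, diag, lift_ofL]
  rfl

@[simp] lemma act_ofR (r s : R) : act k R L (ofR k R L r) s = r * s := by simp [act]

@[simp] lemma act_ofL (x : L) (s : R) : act k R L (ofL k R L x) s = ⁅x, s⁆ := by simp [act]

lemma act_smul (r : R) (u : U k R L) (s : R) : act k R L (r • u) s = r * act k R L u s := by
  rw [smul_def, map_mul, Module.End.mul_apply, act_ofR]

lemma act_ofL_mul (x : L) (u : U k R L) (s : R) :
    act k R L (ofL k R L x * u) s = ⁅x, act k R L u s⁆ := by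
  rw [map_mul, Module.End.mul_apply, act_ofL]

lemma counit_apply (u : U k R L) : counit k R L u = act k R L u 1 := rfl

@[simp] lemma counit_one : counit k R L 1 = 1 := by simp [counit_apply]

lemma counit_mul (u v : U k R L) :
    counit k R L (u * v) = act k R L u (counit k R L v) := by simp [counit_apply]

lemma diagL_smul (x : L) (r : R) (t : U k R L ⊗[R] U k R L) :
    diagL k R L x (r • t) = ⁅x, r⁆ • t + r • diagL k R L x t := by
  induction t with
  | zero => simp
  | add s t hs ht => simp only [smul_add, map_add, hs, ht]; abel
  | tmul u v =>
    simp only [TensorProduct.smul_tmul', diagL_tmul, ofL_mul_smul, TensorProduct.add_tmul, smul_add]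
    abel

lemma comm_diagL (x : L) (t : U k R L ⊗[R] U k R L) :
    TensorProduct.comm R _ _ (diagL k R L x t) = diagL k R L x (TensorProduct.comm R _ _ t) := by
  induction t with
  | zero => simp
  | add s t hs ht => simp only [map_add, hs, ht]
  | tmul u v => simp [add_comm]

lemma counit_rTensor_diagL (x : L) (t : U k R L ⊗[R] U k R L) :
    TensorProduct.lid R _ ((counit k R L).rTensor _ (diagL k R L x t)) =
      ofL k R L x * TensorProduct.lid R _ ((counit k R L).rTensor _ t) := by
  induction t with
  | zero => simp
  | add s t hs ht => simp only [map_add, hs, ht, mul_add]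
  | tmul u v => simp [counit_mul, ofL_mul_smul]

variable (k R L) in
/-- The action of `x : L` on `U ⊗ (U ⊗ U)` by the Leibniz rule. -/
def diagL₃ (x : L) :
    U k R L ⊗[R] (U k R L ⊗[R] U k R L) →+ U k R L ⊗[R] (U k R L ⊗[R] U k R L) :=
  leibnizTensor (fun r => ⁅x, r⁆) (AddMonoidHom.mulLeft (ofL k R L x))
    (diagL k R L x).toAddMonoidHom (ofL_mul_smul x) (diagL_smul x)

@[simp] lemma diagL₃_tmul (x : L) (u : U k R L) (t : U k R L ⊗[R] U k R L) :
    diagL₃ k R L x (u ⊗ₜ t) = (ofL k R L x * u) ⊗ₜ t + u ⊗ₜ diagL k R L x t :=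
  leibnizTensor_tmul u t

lemma lTensor_comul_diagL (x : L) (t : U k R L ⊗[R] U k R L) :
    (comul k R L).lTensor _ (diagL k R L x t) = diagL₃ k R L x ((comul k R L).lTensor _ t) := by
  induction t with
  | zero => simp
  | add s t hs ht => simp only [map_add, hs, ht]
  | tmul u v => simp [comul_ofL_mul]

lemma assoc_diagL_tmul (x : L) (t : U k R L ⊗[R] U k R L) (w : U k R L) :
    TensorProduct.assoc R _ _ _ (diagL k R L x t ⊗ₜ w + t ⊗ₜ (ofL k R L x * w)) =
      diagL₃ k R L x (TensorProduct.assoc R _ _ _ (t ⊗ₜ w)) := by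
  induction t with
  | zero => simp
  | add s t hs ht =>
    simp only [map_add, TensorProduct.add_tmul] at hs ht ⊢
    rw [← hs, ← ht]
    abel
  | tmul u v => simp [TensorProduct.add_tmul, TensorProduct.tmul_add, add_assoc]

lemma assoc_rTensor_comul_diagL (x : L) (t : U k R L ⊗[R] U k R L) :
    TensorProduct.assoc R _ _ _ ((comul k R L).rTensor _ (diagL k R L x t)) =
      diagL₃ k R L x (TensorProduct.assoc R _ _ _ ((comul k R L).rTensor _ t)) := by
  induction t with
  | zero => simp
  | add s t hs ht => simp only [map_add, hs, ht]
  | tmul u v => simp [comul_ofL_mul, ← assoc_diagL_tmul]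

lemma comul_coassoc (u : U k R L) :
    TensorProduct.assoc R _ _ _ ((comul k R L).rTensor _ (comul k R L u)) =
      (comul k R L).lTensor _ (comul k R L u) := by
  induction u using left_induction with
  | one => simp
  | add u v hu hv => simp only [map_add, hu, hv]
  | smul r u hu => simp only [map_smul, hu]
  | ofL_mul x u hu => rw [comul_ofL_mul, assoc_rTensor_comul_diagL, hu, lTensor_comul_diagL]

lemma comm_comul (u : U k R L) : TensorProduct.comm R _ _ (comul k R L u) = comul k R L u := by
  induction u using left_induction with
  | one => simp
  | add u v hu hv => simp only [map_add, hu, hv]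
  | smul r u hu => simp only [map_smul, hu]
  | ofL_mul x u hu => rw [comul_ofL_mul, comm_diagL, hu]

lemma counit_rTensor_comul (u : U k R L) :
    (counit k R L).rTensor _ (comul k R L u) = 1 ⊗ₜ u := by
  rw [← (TensorProduct.lid R _).injective.eq_iff, TensorProduct.lid_tmul, one_smul]
  induction u using left_induction with
  | one => simp
  | add u v hu hv => simp only [map_add, hu, hv]
  | smul r u hu => simp only [map_smul, hu]
  | ofL_mul x u hu => rw [comul_ofL_mul, counit_rTensor_diagL, hu]

lemma counit_lTensor_comul (u : U k R L) :
    (counit k R L).lTensor _ (comul k R L u) = u ⊗ₜ 1 := by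
  rw [← comm_comul, ← LinearMap.comm_comp_rTensor_comp_comm_eq]
  simp [counit_rTensor_comul]

instance : Coalgebra R (U k R L) where
  comul := comul k R L
  counit := counit k R L
  coassoc := LinearMap.ext comul_coassoc
  rTensor_counit_comp_comul := LinearMap.ext counit_rTensor_comul
  lTensor_counit_comp_comul := LinearMap.ext counit_lTensor_comul

lemma coalgebra_comul : (CoalgebraStruct.comul : U k R L →ₗ[R] _) = comul k R L := rfl

instance : Coalgebra.IsCocomm R (U k R L) where
  comm_comp_comul := LinearMap.ext comm_comul

/-! ### The algebra `H` and the action of `U` on it -/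

lemma toConv_dualMul (φ ψ : Dual k R L) :
    toConv (dualMul k R L φ ψ) = toConv φ * toConv ψ := rfl

lemma dualMul_comm (φ ψ : Dual k R L) : dualMul k R L φ ψ = dualMul k R L ψ φ :=
  toConv_injective (mul_comm (toConv φ) (toConv ψ))

lemma dualMul_assoc (φ ψ χ : Dual k R L) :
    dualMul k R L (dualMul k R L φ ψ) χ = dualMul k R L φ (dualMul k R L ψ χ) :=
  toConv_injective (mul_assoc (toConv φ) (toConv ψ) (toConv χ))

lemma one_dualMul (φ : Dual k R L) : dualMul k R L (dualOne k R L) φ = φ :=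
  toConv_injective (one_mul (toConv φ))

lemma etaL_dualMul (r : R) (φ : Dual k R L) : dualMul k R L (etaL k R L r) φ = r • φ :=
  toConv_injective (smul_one_mul r (toConv φ))

lemma etaL_mul (r s : R) :
    etaL k R L (r * s) = dualMul k R L (etaL k R L r) (etaL k R L s) := by
  rw [etaL_dualMul]
  exact mul_smul r s _

@[simp] lemma dualMul_apply_one (φ ψ : Dual k R L) : dualMul k R L φ ψ 1 = φ 1 * ψ 1 := by
  simp [dualMul_apply]

lemma etaL_apply (r : R) (u : U k R L) : etaL k R L r u = r * counit k R L u := rfl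

lemma etaR_apply (r : R) (u : U k R L) : etaR k R L r u = act k R L u r := rfl

lemma etaR_eq_comp_rmul (r : R) : etaR k R L r = dualOne k R L ∘ₗ rmul k R L (ofR k R L r) := by
  ext u
  simp [etaR_apply, dualOne, counit_apply]

lemma etaR_dualMul (r : R) (φ : Dual k R L) :
    dualMul k R L (etaR k R L r) φ = φ ∘ₗ rmul k R L (ofR k R L r) := by
  ext u
  rw [etaR_eq_comp_rmul, dualMul_rmul_left, one_dualMul]
  rfl

lemma etaR_mul (r s : R) :
    etaR k R L (r * s) = dualMul k R L (etaR k R L r) (etaR k R L s) := by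
  ext u
  simp [etaR_dualMul, etaR_apply]

/-- The flat connection `(∇ₓ φ)(u) = x(φ(u)) - φ(x u)` on `H`. -/
def nabla (x : L) : Module.End k (Dual k R L) where
  toFun φ :=
    { toFun := fun u => ⁅x, φ u⁆ - φ (ofL k R L x * u)
      map_add' := fun u v => by simp only [map_add, lie_add, mul_add]; abel
      map_smul' := fun r u => by
        simp only [ofL_mul_smul, map_add, map_smul, smul_eq_mul,
          LieRinehartRing.leibniz_mul_right, RingHom.id_apply]
        ring }
  map_add' φ ψ := by ext u; simp; abel
  map_smul' c φ := by ext u; simp [smul_sub]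

lemma nabla_apply (x : L) (φ : Dual k R L) (u : U k R L) :
    nabla x φ u = ⁅x, φ u⁆ - φ (ofL k R L x * u) := rfl

lemma nabla_dualMul (x : L) (φ ψ : Dual k R L) :
    nabla x (dualMul k R L φ ψ) = dualMul k R L (nabla x φ) ψ + dualMul k R L φ (nabla x ψ) := by
  ext u
  rw [nabla_apply, LinearMap.add_apply]
  simp only [dualMul_apply, comul_ofL_mul]
  induction comul k R L u with
  | zero => simp
  | add a b ha hb => simp only [map_add, lie_add, add_sub_add_comm, ha, hb]; abel
  | tmul a b =>
    simp only [diagL_tmul, map_add, TensorProduct.map_tmul, LinearMap.mul'_apply, nabla_apply,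
      LieRinehartRing.leibniz_mul_right, smul_eq_mul]
    ring

lemma nabla_etaL (x : L) (r : R) : nabla x (etaL k R L r) = etaL k R L ⁅x, r⁆ := by
  ext u
  simp [nabla_apply, etaL_apply, counit_mul]

variable (k R L) in
/-- The action of `U` on `H` by differential operators, given by the flat connection `∇`. -/
def dualAct : U k R L →ₐ[k] Module.End k (Dual k R L) :=
  lift (A := Module.End k (Dual k R L)) (Algebra.lsmul k k (Dual k R L))
    { toFun := nabla
      map_add' := fun x y => by ext φ u; simp [nabla_apply, add_mul]; abel
      map_smul' := fun c x => by ext φ u; simp [nabla_apply, smul_sub] }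
    (fun x y => by
      ext φ u
      simp [nabla_apply, ofL_lie, sub_mul, mul_assoc]
      abel)
    (fun x r => by
      ext φ u
      simp [nabla_apply, mul_sub])
    (fun r x => by
      ext φ u
      simp [nabla_apply, ofL_smul, ← smul_def, mul_sub, smul_mul_assoc])

@[simp] lemma dualAct_ofR (r : R) (φ : Dual k R L) :
    dualAct k R L (ofR k R L r) φ = r • φ := by simp [dualAct]

@[simp] lemma dualAct_ofL (x : L) (φ : Dual k R L) :
    dualAct k R L (ofL k R L x) φ = nabla x φ := by simp [dualAct]

lemma dualAct_smul (r : R) (u : U k R L) (φ : Dual k R L) :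
    dualAct k R L (r • u) φ = r • dualAct k R L u φ := by
  rw [smul_def, map_mul, Module.End.mul_apply, dualAct_ofR]

lemma dualAct_ofL_mul (x : L) (u : U k R L) (φ : Dual k R L) :
    dualAct k R L (ofL k R L x * u) φ = nabla x (dualAct k R L u φ) := by
  rw [map_mul, Module.End.mul_apply, dualAct_ofL]

lemma dualAct_comp_rmul (u a : U k R L) (φ : Dual k R L) :
    dualAct k R L u (φ ∘ₗ rmul k R L a) = dualAct k R L u φ ∘ₗ rmul k R L a := by
  induction u using left_induction with
  | one => simp
  | add u v hu hv => simp only [map_add, LinearMap.add_apply, hu, hv, LinearMap.add_comp]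
  | smul r u hu => rw [dualAct_smul, dualAct_smul, hu, LinearMap.smul_comp]
  | ofL_mul x u hu =>
    rw [dualAct_ofL_mul, dualAct_ofL_mul, hu]
    ext v
    simp [nabla_apply, mul_assoc]

lemma dualAct_etaL (u : U k R L) (r : R) :
    dualAct k R L u (etaL k R L r) = etaL k R L (act k R L u r) := by
  induction u using left_induction with
  | one => simp
  | add u v hu hv => simp only [map_add, LinearMap.add_apply, hu, hv]
  | smul s u hu =>
    rw [dualAct_smul, hu, act_smul, etaL_mul, etaL_dualMul]
  | ofL_mul x u hu => rw [dualAct_ofL_mul, hu, nabla_etaL, act_ofL_mul]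

/-- The orbit map `u ↦ u · φ` of `φ : H`, in the convolution algebra `Hom_R(U, H)`. -/
def orbit (φ : Dual k R L) : WithConv (U k R L →ₗ[R] WithConv (Dual k R L)) :=
  toConv
    { toFun := fun u => toConv (dualAct k R L u φ)
      map_add' := fun u v => by simp
      map_smul' := fun r u => by simp [dualAct_smul] }

lemma orbit_apply (φ : Dual k R L) (u : U k R L) :
    orbit φ u = toConv (dualAct k R L u φ) := rfl

lemma orbit_mul_orbit_ofL_mul (φ ψ : Dual k R L) (x : L) (u : U k R L) :
    (orbit φ * orbit ψ) (ofL k R L x * u) = toConv (nabla x ((orbit φ * orbit ψ) u).ofConv) := by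
  rw [LinearMap.convMul_apply, LinearMap.convMul_apply, coalgebra_comul, comul_ofL_mul]
  induction comul k R L u with
  | zero => simp
  | add a b ha hb => simp only [map_add, ha, hb, ofConv_add, toConv_add]
  | tmul a b =>
    simp [orbit_apply, ← toConv_dualMul, nabla_dualMul]

/-- `U` acts on products through its coproduct: `H` is a `U`-module algebra. -/
lemma orbit_dualMul (φ ψ : Dual k R L) : orbit (dualMul k R L φ ψ) = orbit φ * orbit ψ := by
  ext u : 2
  induction u using left_induction with
  | one =>
    simp [LinearMap.convMul_apply, coalgebra_comul, orbit_apply, toConv_dualMul]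
  | add u v hu hv => simp only [map_add, hu, hv]
  | smul r u hu => simp only [map_smul, hu]
  | ofL_mul x u hu =>
    rw [orbit_mul_orbit_ofL_mul, ← hu, orbit_apply, orbit_apply, dualAct_ofL_mul]

/-! ### The antipode and the completed tensor square -/

variable (k R L) in
/-- Evaluation at `1 : U`, as a morphism from the convolution algebra `H` to `R`. -/
def evalOne : WithConv (Dual k R L) →ₐ[R] R :=
  AlgHom.ofLinearMap
    { toFun := fun φ => φ.ofConv 1
      map_add' := fun _ _ => rfl
      map_smul' := fun _ _ => rfl }
    counit_one (fun φ ψ => dualMul_apply_one φ.ofConv ψ.ofConv)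

variable (k R L) in
/-- The antipode `S(φ)(u) = (u · φ)(1)` of `H`. -/
def antipode : Dual k R L →ₗ[k] Dual k R L where
  toFun φ := (evalOne k R L).toLinearMap ∘ₗ (orbit φ).ofConv
  map_add' φ ψ := LinearMap.ext fun u =>
    LinearMap.congr_fun (map_add (dualAct k R L u) φ ψ) (1 : U k R L)
  map_smul' c φ := LinearMap.ext fun u =>
    LinearMap.congr_fun (map_smul (dualAct k R L u) c φ) (1 : U k R L)

lemma antipode_apply (φ : Dual k R L) (u : U k R L) :
    antipode k R L φ u = dualAct k R L u φ 1 := rfl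

@[simp] lemma antipode_apply_one (φ : Dual k R L) : antipode k R L φ 1 = φ 1 := by
  simp [antipode_apply]

lemma antipode_dualMul (φ ψ : Dual k R L) : antipode k R L (dualMul k R L φ ψ) =
    dualMul k R L (antipode k R L φ) (antipode k R L ψ) := by
  change (evalOne k R L).toLinearMap ∘ₗ (orbit (dualMul k R L φ ψ)).ofConv = _
  rw [orbit_dualMul, LinearMap.algHom_comp_convMul_distrib]
  rfl

lemma dualAct_antipode_apply (φ : Dual k R L) (u v : U k R L) :
    dualAct k R L u (antipode k R L φ) v = dualAct k R L v φ u := by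
  induction u using left_induction generalizing v with
  | one => simp [antipode_apply]
  | add u u' hu hu' => simp only [map_add, LinearMap.add_apply, hu, hu']
  | smul r u hu => simp only [dualAct_smul, LinearMap.smul_apply, map_smul, hu]
  | ofL_mul x u hu =>
    rw [dualAct_ofL_mul, nabla_apply, hu, hu, dualAct_ofL_mul, nabla_apply, sub_sub_cancel]

lemma antipode_antipode (φ : Dual k R L) : antipode k R L (antipode k R L φ) = φ := by
  ext u
  simp [antipode_apply, dualAct_antipode_apply]

lemma dualAct_antipode (u : U k R L) (φ : Dual k R L) :
    dualAct k R L u (antipode k R L φ) = antipode k R L (φ ∘ₗ rmul k R L u) := by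
  ext v
  rw [dualAct_antipode_apply, antipode_apply, dualAct_comp_rmul]
  simp

lemma antipode_etaL (r : R) : antipode k R L (etaL k R L r) = etaR k R L r := by
  ext u
  simp [antipode_apply, dualAct_etaL, etaL_apply, etaR_apply]

lemma antipode_etaR (r : R) : antipode k R L (etaR k R L r) = etaL k R L r := by
  rw [← antipode_etaL, antipode_antipode]

lemma etaL_one : etaL k R L 1 = dualOne k R L := one_smul R _

lemma etaR_one : etaR k R L 1 = dualOne k R L := rfl

lemma antipode_one : antipode k R L (dualOne k R L) = dualOne k R L := by
  rw [← etaR_one, antipode_etaR, etaL_one, etaR_one]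

lemma tmul_apply (φ ψ : Dual k R L) (u v : U k R L) :
    (tmul k R L φ ψ).1 u v = φ (u * ofR k R L (ψ v)) := rfl

lemma slice_tmul (φ ψ : Dual k R L) (v : U k R L) :
    slice (tmul k R L φ ψ) v = dualMul k R L (etaR k R L (ψ v)) φ := by
  ext u
  rw [etaR_dualMul]
  rfl

lemma slice_injective {F G : Dual₂ k R L} (h : ∀ v, slice F v = slice G v) : F = G := by
  ext u v
  exact DFunLike.congr_fun (h v) u

lemma slice_dualMul₂ (F G : Dual₂ k R L) (v : U k R L) :
    slice (dualMul₂ k R L F G) v = sliceMul F G (comul k R L v) := rfl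

lemma slice_dualComul (φ : Dual k R L) (v : U k R L) :
    slice (dualComul k R L φ) v = φ ∘ₗ rmul k R L v := rfl

/-- The embedding of `H ⊗̂_R H` in the convolution algebra `Hom_R(U, H)` which sends `F` to
`v ↦ S(F(-, v))`: the antipode turns the balancing of `F`, which involves the right unit, into left
`R`-linearity. -/
def antipodeCurry (F : Dual₂ k R L) : WithConv (U k R L →ₗ[R] WithConv (Dual k R L)) :=
  toConv
    { toFun := fun v => toConv (antipode k R L (slice F v))
      map_add' := fun v w => by simp
      map_smul' := fun r v => by simp [slice_smul, ← dualAct_antipode] }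

lemma antipodeCurry_apply (F : Dual₂ k R L) (v : U k R L) :
    antipodeCurry F v = toConv (antipode k R L (slice F v)) := rfl

lemma antipodeCurry_injective : Function.Injective (antipodeCurry (k := k) (R := R) (L := L)) := by
  intro F G h
  refine slice_injective fun v => ?_
  have hv : antipode k R L (slice F v) = antipode k R L (slice G v) :=
    congrArg (fun f : WithConv (U k R L →ₗ[R] WithConv (Dual k R L)) => (f v).ofConv) h
  rw [← antipode_antipode (slice F v), hv, antipode_antipode]

lemma antipodeCurry_dualMul₂ (F G : Dual₂ k R L) : antipodeCurry (dualMul₂ k R L F G) =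
    antipodeCurry F * antipodeCurry G := by
  ext v : 2
  rw [antipodeCurry_apply, slice_dualMul₂, LinearMap.convMul_apply, coalgebra_comul]
  induction comul k R L v with
  | zero => simp
  | add a b ha hb => simp only [map_add, toConv_add, ha, hb]
  | tmul a b => simp [antipode_dualMul, toConv_dualMul, antipodeCurry_apply]

lemma antipodeCurry_tmul_apply (φ ψ : Dual k R L) (v : U k R L) :
    antipodeCurry (tmul k R L φ ψ) v = ψ v • toConv (antipode k R L φ) := by
  rw [antipodeCurry_apply, slice_tmul, antipode_dualMul, antipode_etaR, etaL_dualMul, toConv_smul]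

lemma antipodeCurry_one :
    antipodeCurry (tmul k R L (dualOne k R L) (dualOne k R L)) = 1 := by
  ext v : 2
  rw [antipodeCurry_tmul_apply, antipode_one, LinearMap.convOne_apply,
    Algebra.algebraMap_eq_smul_one]
  rfl

lemma antipodeCurry_dualComul (φ : Dual k R L) :
    antipodeCurry (dualComul k R L φ) = orbit (antipode k R L φ) := by
  ext v : 2
  rw [antipodeCurry_apply, slice_dualComul, orbit_apply, dualAct_antipode]

lemma dualMul₂_comm (F G : Dual₂ k R L) : dualMul₂ k R L F G = dualMul₂ k R L G F :=
  antipodeCurry_injective <| by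
    rw [antipodeCurry_dualMul₂, antipodeCurry_dualMul₂]
    exact mul_comm (antipodeCurry F) (antipodeCurry G)

lemma dualMul₂_assoc (F G K : Dual₂ k R L) :
    dualMul₂ k R L (dualMul₂ k R L F G) K = dualMul₂ k R L F (dualMul₂ k R L G K) :=
  antipodeCurry_injective <| by
    simp only [antipodeCurry_dualMul₂]
    exact mul_assoc (antipodeCurry F) (antipodeCurry G) (antipodeCurry K)

lemma one_dualMul₂ (F : Dual₂ k R L) :
    dualMul₂ k R L (tmul k R L (dualOne k R L) (dualOne k R L)) F = F :=
  antipodeCurry_injective <| by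
    rw [antipodeCurry_dualMul₂, antipodeCurry_one]
    exact one_mul (antipodeCurry F)

lemma tmul_dualMul₂ (φ ψ φ' ψ' : Dual k R L) :
    dualMul₂ k R L (tmul k R L φ ψ) (tmul k R L φ' ψ') =
      tmul k R L (dualMul k R L φ φ') (dualMul k R L ψ ψ') := by
  refine antipodeCurry_injective (WithConv.ext (LinearMap.ext fun v => ?_))
  change antipodeCurry _ v = antipodeCurry _ v
  rw [antipodeCurry_dualMul₂, antipodeCurry_tmul_apply, LinearMap.convMul_apply, coalgebra_comul,
    antipode_dualMul, toConv_dualMul, dualMul_apply]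
  induction comul k R L v with
  | zero => simp
  | add a b ha hb => simp only [map_add, ha, hb, add_smul]
  | tmul a b => simp [antipodeCurry_tmul_apply, mul_smul_mul_comm]

lemma dualComul_mul (φ ψ : Dual k R L) : dualComul k R L (dualMul k R L φ ψ) =
    dualMul₂ k R L (dualComul k R L φ) (dualComul k R L ψ) :=
  antipodeCurry_injective <| by
    simp only [antipodeCurry_dualMul₂, antipodeCurry_dualComul, antipode_dualMul, orbit_dualMul]

lemma dualComul_etaL (r : R) :
    dualComul k R L (etaL k R L r) = tmul k R L (etaL k R L r) (dualOne k R L) := by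
  ext u v
  change r * counit k R L (u * v) = r * counit k R L (u * ofR k R L (counit k R L v))
  simp [counit_apply]

lemma dualComul_one :
    dualComul k R L (dualOne k R L) = tmul k R L (dualOne k R L) (dualOne k R L) := by
  rw [← etaL_one, dualComul_etaL, etaL_one]

variable (k R L) in
/-- The map `μ(S ⊗ id) : H ⊗̂_R H → H`, `F ↦ (u ↦ ∑ S(F(-, u₂))(u₁))`. -/
def antipodeId : Dual₂ k R L →ₗ[k] Dual k R L where
  toFun F := (convUncurry (antipodeCurry F)).ofConv ∘ₗ comul k R L
  map_add' F G := by
    rw [← LinearMap.add_comp]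
    congr 1
    ext a b
    simp [antipodeCurry_apply, slice_add]
  map_smul' c F := by
    rw [RingHom.id_apply, ← LinearMap.smul_comp]
    congr 1
    ext a b
    simp [antipodeCurry_apply, slice_smul']

lemma antipodeId_apply (F : Dual₂ k R L) (u : U k R L) :
    antipodeId k R L F u = convUncurry (antipodeCurry F) (comul k R L u) := rfl

lemma antipodeId_dualMul₂ (F G : Dual₂ k R L) : antipodeId k R L (dualMul₂ k R L F G) =
    dualMul k R L (antipodeId k R L F) (antipodeId k R L G) := by
  change (convUncurry (antipodeCurry (dualMul₂ k R L F G))).ofConv ∘ₗ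
    (Coalgebra.comulCoalgHom R (U k R L)).toLinearMap = _
  rw [antipodeCurry_dualMul₂, convUncurry_mul, LinearMap.convMul_comp_coalgHom_distrib]
  rfl

lemma antipodeId_tmul (φ ψ : Dual k R L) :
    antipodeId k R L (tmul k R L φ ψ) = dualMul k R L (antipode k R L φ) ψ := by
  ext u
  rw [antipodeId_apply, dualMul_apply]
  induction comul k R L u with
  | zero => simp
  | add a b ha hb => simp only [map_add, ha, hb]
  | tmul a b => simp [antipodeCurry_tmul_apply, mul_comm]

lemma convUncurry_orbit_diagL (φ : Dual k R L) (x : L) (t : U k R L ⊗[R] U k R L) :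
    convUncurry (orbit φ) (diagL k R L x t) = ⁅x, convUncurry (orbit φ) t⁆ := by
  induction t with
  | zero => simp
  | add s t hs ht => simp only [map_add, hs, ht, lie_add]
  | tmul a b => simp [orbit_apply, nabla_apply]

lemma convUncurry_orbit_comul (φ : Dual k R L) (u : U k R L) :
    convUncurry (orbit φ) (comul k R L u) = act k R L u (φ 1) := by
  induction u using left_induction with
  | one => simp [orbit_apply]
  | add u v hu hv => simp only [map_add, LinearMap.add_apply, hu, hv]
  | smul r u hu => rw [map_smul, map_smul, hu, act_smul, smul_eq_mul]
  | ofL_mul x u hu =>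
    rw [comul_ofL_mul, convUncurry_orbit_diagL, hu, act_ofL_mul]

lemma antipodeId_dualComul (φ : Dual k R L) :
    antipodeId k R L (dualComul k R L φ) = etaR k R L (φ 1) := by
  ext u
  rw [antipodeId_apply, antipodeCurry_dualComul, convUncurry_orbit_comul, antipode_apply_one,
    etaR_apply]

/-! ### Continuity -/

section Topology

variable [TopologicalSpace R] {X : Type*} [TopologicalSpace X]

lemma continuous_dual_iff {f : X → Dual k R L} :
    Continuous f ↔ ∀ u, Continuous fun a => f a u :=
  continuous_induced_rng.trans continuous_pi_iff

lemma continuous_dual₂_iff {f : X → Dual₂ k R L} :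
    Continuous f ↔ ∀ u v, Continuous fun a => (f a).1 u v :=
  (continuous_induced_rng.trans continuous_pi_iff).trans Prod.forall

lemma continuous_dual₃ {f : X → Dual₃ k R L}
    (h : ∀ u v w, Continuous fun a => (f a).1 u v w) : Continuous f :=
  continuous_induced_rng.2 (continuous_pi fun p => h p.1 p.2.1 p.2.2)

lemma continuous_eval (u : U k R L) : Continuous fun φ : Dual k R L => φ u :=
  continuous_dual_iff.1 continuous_id u

lemma continuous_eval₂ (u v : U k R L) : Continuous fun F : Dual₂ k R L => F.1 u v :=
  continuous_dual₂_iff.1 continuous_id u v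

lemma continuous_slice (v : U k R L) : Continuous fun F : Dual₂ k R L => slice F v :=
  continuous_dual_iff.2 fun u => continuous_eval₂ u v

lemma continuous_idCounit : Continuous (idCounit k R L) := continuous_slice 1

lemma continuous_counitId : Continuous (counitId k R L) :=
  continuous_dual_iff.2 fun v => continuous_eval₂ 1 v

lemma continuous_comulId : Continuous (comulId k R L) :=
  continuous_dual₃ fun u v w => continuous_eval₂ (u * v) w

lemma continuous_idComul : Continuous (idComul k R L) :=
  continuous_dual₃ fun u v w => continuous_eval₂ u (v * w)

lemma continuous_dualComul : Continuous (dualComul k R L) :=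
  continuous_dual₂_iff.2 fun u v => continuous_eval (u * v)

variable [IsTopologicalRing R]

instance : ContinuousAdd (Dual k R L) where
  continuous_add := continuous_dual_iff.2 fun u =>
    ((continuous_eval u).comp continuous_fst).add ((continuous_eval u).comp continuous_snd)

instance : ContinuousAdd (Dual₂ k R L) where
  continuous_add := continuous_dual₂_iff.2 fun u v =>
    ((continuous_eval₂ u v).comp continuous_fst).add ((continuous_eval₂ u v).comp continuous_snd)

lemma continuous_etaL : Continuous (etaL k R L) :=
  continuous_dual_iff.2 fun _ => continuous_id.mul continuous_const

lemma continuous_dualMul {f g : X → Dual k R L} (hf : Continuous f) (hg : Continuous g) :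
    Continuous fun a => dualMul k R L (f a) (g a) :=
  continuous_dual_iff.2 fun u =>
    continuous_apply_of_tmul
      (f := fun a => LinearMap.mul' R R ∘ₗ TensorProduct.map (f a) (g a))
      (fun v w => (continuous_dual_iff.1 hf v).mul (continuous_dual_iff.1 hg w)) (comul k R L u)

lemma continuous_sliceMul (t : U k R L ⊗[R] U k R L) :
    Continuous fun p : Dual₂ k R L × Dual₂ k R L => sliceMul p.1 p.2 t :=
  continuous_apply_of_tmul (fun v w => by
    simpa only [sliceMul_tmul] using! continuous_dualMul ((continuous_slice v).comp continuous_fst)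
      ((continuous_slice w).comp continuous_snd)) t

lemma continuous_dualMul₂ :
    Continuous fun p : Dual₂ k R L × Dual₂ k R L => dualMul₂ k R L p.1 p.2 :=
  continuous_dual₂_iff.2 fun u v => (continuous_eval u).comp (continuous_sliceMul (comul k R L v))

variable (hcont : ∀ x : L, Continuous fun r : R => ⁅x, r⁆)
include hcont

lemma continuous_act (u : U k R L) : Continuous fun r => act k R L u r := by
  induction u using left_induction with
  | one => simpa only [map_one] using! continuous_id
  | add u v hu hv => simpa only [map_add] using! hu.add hv
  | smul r u hu => simpa only [act_smul] using! hu.const_mul r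
  | ofL_mul x u hu => simpa only [act_ofL_mul] using! (hcont x).comp hu

lemma continuous_etaR : Continuous (etaR k R L) :=
  continuous_dual_iff.2 (continuous_act hcont)

lemma continuous_tmul : Continuous fun p : Dual k R L × Dual k R L => tmul k R L p.1 p.2 := by
  refine continuous_dual₂_iff.2 fun u v => ?_
  simp only [← slice_apply, slice_tmul]
  exact continuous_dual_iff.1 (continuous_dualMul
    ((continuous_etaR hcont).comp ((continuous_eval v).comp continuous_snd)) continuous_fst) u

lemma continuous_dualAct (u : U k R L) : Continuous (dualAct k R L u) := by
  refine continuous_dual_iff.2 fun v => ?_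
  induction u using left_induction generalizing v with
  | one => simpa using continuous_eval v
  | add u u' hu hu' => simpa only [map_add] using! (hu v).add (hu' v)
  | smul r u hu =>
    simpa only [dualAct_smul] using! (hu v).const_mul r
  | ofL_mul x u hu =>
    simpa only [dualAct_ofL_mul, nabla_apply] using! ((hcont x).comp (hu v)).sub (hu _)

lemma continuous_antipode : Continuous (antipode k R L) :=
  continuous_dual_iff.2 fun u => (continuous_eval 1).comp (continuous_dualAct hcont u)

lemma continuous_antipodeId : Continuous (antipodeId k R L) :=
  continuous_dual_iff.2 fun u =>
    continuous_apply_of_tmul (f := fun F : Dual₂ k R L => (convUncurry (antipodeCurry F)).ofConv)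
      (fun v w => (continuous_eval v).comp ((continuous_antipode hcont).comp (continuous_slice w)))
      (comul k R L u)

end Topology

/-! ### The bialgebroid and antipode axioms -/

lemma tmul_balanced (φ : Dual k R L) (r : R) (ψ : Dual k R L) :
    tmul k R L (dualMul k R L φ (etaR k R L r)) ψ =
      tmul k R L φ (dualMul k R L (etaL k R L r) ψ) := by
  ext u v
  rw [dualMul_comm, etaR_dualMul, etaL_dualMul]
  simp [tmul_apply, mul_assoc, ← map_mul, mul_comm]

lemma idCounit_tmul (φ ψ : Dual k R L) :
    idCounit k R L (tmul k R L φ ψ) = dualMul k R L φ (etaR k R L (ψ 1)) := by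
  rw [dualMul_comm, ← slice_tmul]
  rfl

lemma counitId_tmul (φ ψ : Dual k R L) :
    counitId k R L (tmul k R L φ ψ) = dualMul k R L (etaL k R L (φ 1)) ψ := by
  rw [etaL_dualMul]
  ext v
  change φ (1 * ofR k R L (ψ v)) = φ 1 * ψ v
  rw [one_mul, ← mul_one (ofR k R L (ψ v)), ← smul_def, map_smul, smul_eq_mul, mul_comm]

lemma comulId_tmul (φ ψ : Dual k R L) :
    comulId k R L (tmul k R L φ ψ) = tmul₂₁ (dualComul k R L φ) ψ := by
  ext u v w
  exact congrArg φ (mul_assoc u v _)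

lemma idCounit_dualComul (φ : Dual k R L) : idCounit k R L (dualComul k R L φ) = φ :=
  LinearMap.ext fun u => congrArg φ (mul_one u)

lemma counitId_dualComul (φ : Dual k R L) : counitId k R L (dualComul k R L φ) = φ :=
  LinearMap.ext fun u => congrArg φ (one_mul u)

lemma etaL_apply_one (r : R) : etaL k R L r 1 = r := by simp [etaL_apply]

lemma etaR_apply_one (r : R) : etaR k R L r 1 = r := by simp [etaR_apply]

lemma dualComul_etaR (r : R) :
    dualComul k R L (etaR k R L r) = tmul k R L (dualOne k R L) (etaR k R L r) := by
  ext u v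
  change act k R L (u * v) r = counit k R L (u * ofR k R L (act k R L v r))
  simp [counit_apply]

lemma dualComul_coassoc (φ : Dual k R L) :
    idComul k R L (dualComul k R L φ) = comulId k R L (dualComul k R L φ) := by
  ext u v w
  exact congrArg φ (mul_assoc u v w).symm

variable (k R L) in
theorem dualData_isBialgebroid [TopologicalSpace R] [IsTopologicalRing R]
    (hcont : ∀ x : L, Continuous fun r : R => ⁅x, r⁆) : (dualData k R L).IsBialgebroid where
  mul_comm := dualMul_comm
  mul_assoc := dualMul_assoc
  one_mul := one_dualMul
  continuous_add := continuous_add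
  continuous_mul := continuous_dualMul continuous_fst continuous_snd
  mul₂_comm := dualMul₂_comm
  mul₂_assoc := dualMul₂_assoc
  one_mul₂ := one_dualMul₂
  continuous_add₂ := continuous_add
  continuous_mul₂ := continuous_dualMul₂
  tmul_balanced := tmul_balanced
  tmul_mul := tmul_dualMul₂
  continuous_tmul := continuous_tmul hcont
  tmul_assoc _ _ _ := rfl
  idε_tmul := idCounit_tmul
  εid_tmul := counitId_tmul
  Δid_tmul := comulId_tmul
  idΔ_tmul _ _ := rfl
  continuous_idε := continuous_idCounit
  continuous_εid := continuous_counitId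
  continuous_Δid := continuous_comulId
  continuous_idΔ := continuous_idComul
  ηL_one := etaL_one
  ηL_mul := etaL_mul
  continuous_ηL := continuous_etaL
  ηR_one := etaR_one
  ηR_mul := etaR_mul
  continuous_ηR := continuous_etaR hcont
  ε_one := counit_one
  ε_mul := dualMul_apply_one
  continuous_ε := continuous_eval 1
  idε_Δ := idCounit_dualComul
  εid_Δ := counitId_dualComul
  ε_ηL := etaL_apply_one
  ε_ηR := etaR_apply_one
  Δ_ηL := dualComul_etaL
  Δ_ηR := dualComul_etaR
  coassoc := dualComul_coassoc
  Δ_one := dualComul_one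
  Δ_mul := dualComul_mul
  continuous_Δ := continuous_dualComul

lemma antipode_antipodeId_tmul (φ ψ : Dual k R L) :
    antipode k R L (antipodeId k R L (tmul k R L φ ψ)) = dualMul k R L φ (antipode k R L ψ) := by
  rw [antipodeId_tmul, antipode_dualMul, antipode_antipode]

lemma antipode_antipodeId_dualMul₂ (F G : Dual₂ k R L) :
    antipode k R L (antipodeId k R L (dualMul₂ k R L F G)) =
      dualMul k R L (antipode k R L (antipodeId k R L F))
        (antipode k R L (antipodeId k R L G)) := by
  rw [antipodeId_dualMul₂, antipode_dualMul]

lemma antipode_antipodeId_dualComul (φ : Dual k R L) :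
    antipode k R L (antipodeId k R L (dualComul k R L φ)) = etaL k R L (φ 1) := by
  rw [antipodeId_dualComul, antipode_etaR]

variable (k R L) in
theorem dualData_isAntipode [TopologicalSpace R] [IsTopologicalRing R]
    (hcont : ∀ x : L, Continuous fun r : R => ⁅x, r⁆) :
    (dualData k R L).IsAntipode (antipode k R L) (antipode k R L ∘ₗ antipodeId k R L)
      (antipodeId k R L) where
  S_one := antipode_one
  S_mul := antipode_dualMul
  continuous_S := continuous_antipode hcont
  S_ηL := antipode_etaL
  S_ηR := antipode_etaR
  idS_tmul := antipode_antipodeId_tmul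
  Sid_tmul := antipodeId_tmul
  idS_mul := antipode_antipodeId_dualMul₂
  Sid_mul := antipodeId_dualMul₂
  continuous_idS := (continuous_antipode hcont).comp (continuous_antipodeId hcont)
  continuous_Sid := continuous_antipodeId hcont
  idS_Δ := antipode_antipodeId_dualComul
  Sid_Δ := antipodeId_dualComul

end LieRinehartDual

end

theorem mainTheorem5 (k R L : Type*) [CommRing k] [CommRing R] [Algebra k R] [LieRing L]
    [LieAlgebra k L] [Module R L] [LieRingModule L R] [LieRinehartRing R L]
    [LieRinehartAlgebra k R L] [TopologicalSpace R] [IsTopologicalRing R]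
    (hcont : ∀ x : L, Continuous fun r : R => ⁅x, r⁆) :
    (LieRinehartDual.dualData k R L).IsBialgebroid ∧
    ∃ (S : LieRinehartDual.Dual k R L →ₗ[k] LieRinehartDual.Dual k R L)
      (idS Sid : LieRinehartDual.Dual₂ k R L →ₗ[k] LieRinehartDual.Dual k R L),
      (LieRinehartDual.dualData k R L).IsAntipode S idS Sid ∧
      (∀ (F : LieRinehartDual.Dual₂ k R L) (u : LieRinehartDual.U k R L) (n : ℕ)
        (a b : Fin n → LieRinehartDual.U k R L),
        LieRinehartDual.comul k R L u = ∑ i, a i ⊗ₜ[R] b i →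
        Sid F u = ∑ i, S (LieRinehartDual.slice F (b i)) (a i)) ∧
      ∀ F : LieRinehartDual.Dual₂ k R L, idS F = S (Sid F) := by
  refine ⟨LieRinehartDual.dualData_isBialgebroid k R L hcont, LieRinehartDual.antipode k R L,
    LieRinehartDual.antipode k R L ∘ₗ LieRinehartDual.antipodeId k R L,
    LieRinehartDual.antipodeId k R L, LieRinehartDual.dualData_isAntipode k R L hcont,
    fun F u n a b h => ?_, fun F => rfl⟩
  simp [LieRinehartDual.antipodeId_apply, h, LieRinehartDual.antipodeCurry_apply]
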